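/- Let $X$ be a closed (compact, without boundary) Kähler manifold of complex dimension $n$, oriented by its complex structure, and let $\Omega^{*,*}(X)=\bigoplus_k\Omega^k(X)$ be the algebra of smooth complex valued differential forms on $X$, with the $\mathbb Z/2$-grading by total degree. Let $\int_X:\Omega^{*,*}(X)\to\mathbb C$ be the ordinary integration of differential forms (the integral over $X$ of the component of degree $2n$). Let $\star$ be the conjugate linear Hodge star, given by $\alpha\wedge\star\beta=\langle\alpha,\beta\rangle\,\mathrm{vol}$ with $\langle\cdot,\cdot\rangle$ the pointwise Hermitian inner product of forms, and let $\partial^*=-\star\partial\star$. Then $\partial^*$ is the formal adjoint of $\partial$ for the $L^2$ inner product $(\alpha,\beta)=\int_X\langle\alpha,\beta\rangle\,\mathrm{vol}$, that is, $(\partial a,b)=(a,\partial^*b)$ for all $a,b\in\Omega^{*,*}(X)$, and $\int_X$ is an integral for $(\Omega^{*,*}(X),\wedge,\delta=\bar\partial,\Delta=\partial^*)$: it is $\mathbb C$-linear and even (it vanishes on forms of odd degree), and for every homogeneous $a\in\Omega^{*,*}(X)$, of degree $|a|$, and every $b\in\Omega^{*,*}(X)$, $$\int_X \bar\partial a\wedge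 b=(-1)^{|a|+1}\int_X a\wedge\bar\partial b,\qquad \int_X \partial^* a\wedge b=(-1)^{|a|}\int_X a\wedge\partial^* b .$$ -/

import Mathlib

open scoped Manifold ContDiff Topology
open MeasureTheory Set

namespace KaehlerForms

/-- The model space `ℂⁿ`. -/
abbrev Cn (n : ℕ) : Type := Fin n → ℂ

/-- `ℂⁿ` is a manifold with the identity as its only chart. -/
noncomputable instance (n : ℕ) : ChartedSpace (Cn n) (Cn n) := chartedSpaceSelf (Cn n)

/-! ### Pointwise exterior algebra

`Alt n k` is the space of complex valued real `k`-forms on the real vector space `ℂⁿ`, i.e. the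
degree `k` part of `Λ(ℂⁿ)* ⊗ ℂ`. -/

/-- Complex valued, real multilinear alternating `k`-forms on `ℂⁿ`. -/
abbrev Alt (n k : ℕ) : Type := (Cn n) [⋀^Fin k]→L[ℝ] ℂ

/-- A multilinear map on a finite dimensional space is continuous. -/
theorem continuous_multilinear {n : ℕ} {ι : Type*} [Fintype ι]
    (f : MultilinearMap ℝ (fun _ : ι => Cn n) ℂ) : Continuous f := by
  classical
  let b := Module.finBasis ℝ (Cn n)
  have key : ∀ v : ι → Cn n, f v = ∑ r : ι → Fin (Module.finrank ℝ (Cn n)),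
      (∏ i, b.equivFunL (v i) (r i)) • f (fun i => b (r i)) := by
    intro v
    have h1 : v = fun i => ∑ j, b.equivFunL (v i) j • b j := by
      funext i
      exact (b.sum_repr (v i)).symm
    conv_lhs => rw [h1]
    rw [MultilinearMap.map_sum]
    exact Finset.sum_congr rfl fun r _ => MultilinearMap.map_smul_univ f _ _
  have h2 : (f : (ι → Cn n) → ℂ) = fun v => ∑ r : ι → Fin (Module.finrank ℝ (Cn n)),
      (∏ i, b.equivFunL (v i) (r i)) • f (fun i => b (r i)) := funext key
  rw [h2]
  fun_prop

/-- An alternating map, regarded as a continuous one. -/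
noncomputable def toAlt {n k : ℕ} (f : (Cn n) [⋀^Fin k]→ₗ[ℝ] ℂ) : Alt n k :=
  { f with cont := continuous_multilinear f.toMultilinearMap }

/-- The wedge product `(α ∧ β)(v) = ∑ sign(σ) α(v_{σ 1}, …, v_{σ k}) β(v_{σ (k+1)}, …, v_{σ (k+l)})`,
the sum being over the `(k, l)`-shuffles `σ`. -/
noncomputable def wedgeAt {n k l : ℕ} (α : Alt n k) (β : Alt n l) : Alt n (k + l) :=
  toAlt (((LinearMap.mul' ℝ ℂ).compAlternatingMap
    (AlternatingMap.domCoprod α.toAlternatingMap β.toAlternatingMap)).domDomCongr finSumFinEquiv)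

/-- Transport of a form along an equality of degrees. -/
noncomputable def castAt {n k m : ℕ} (h : k = m) (α : Alt n k) : Alt n m :=
  toAlt (α.toAlternatingMap.domDomCongr (finCongr h))

/-- The real frame `e₁, i e₁, e₂, i e₂, …, e_n, i e_n` of `ℂⁿ`. It is positively oriented for the
orientation given by the complex structure. -/
noncomputable def frame (n : ℕ) (j : Fin (2 * n)) : Cn n :=
  Pi.single ⟨j / 2, by omega⟩ (if (j : ℕ) % 2 = 0 then 1 else Complex.I)

/-- The real coordinates `x₁, y₁, …, x_n, y_n`, which are dual to `frame`. -/
noncomputable def realCoords (n : ℕ) : Cn n →ₗ[ℝ] (Fin (2 * n) → ℝ) where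
  toFun z j := if (j : ℕ) % 2 = 0 then (z ⟨j / 2, by omega⟩).re else (z ⟨j / 2, by omega⟩).im
  map_add' z w := by
    funext j
    by_cases h : (j : ℕ) % 2 = 0 <;> simp [h]
  map_smul' c z := by
    funext j
    by_cases h : (j : ℕ) % 2 = 0 <;> simp [h]

/-- The Gram matrix of a bilinear form in the real frame. -/
noncomputable def gram {n : ℕ} (g : Cn n →L[ℝ] Cn n →L[ℝ] ℝ) :
    Matrix (Fin (2 * n)) (Fin (2 * n)) ℝ :=
  Matrix.of fun i j => g (frame n i) (frame n j)

/-- The oriented Riemannian volume form `√(det g) dx₁ ∧ dy₁ ∧ ⋯ ∧ dx_n ∧ dy_n`, as an algebraic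
alternating map. -/
noncomputable def volAlg {n : ℕ} (g : Cn n →L[ℝ] Cn n →L[ℝ] ℝ) :
    (Cn n) [⋀^Fin (2 * n)]→ₗ[ℝ] ℂ :=
  (Real.sqrt (gram g).det) •
    (Complex.ofRealCLM.toLinearMap.compAlternatingMap
      (Matrix.detRowAlternating.compLinearMap (realCoords n)))

/-- The oriented Riemannian volume form. -/
noncomputable def volAt {n : ℕ} (g : Cn n →L[ℝ] Cn n →L[ℝ] ℝ) : Alt n (2 * n) :=
  toAlt (volAlg g)

/-- The Hermitian inner product which a Euclidean inner product `g` induces on complex valued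
`k`-forms, linear in `α` and conjugate linear in `β`:
`⟨α, β⟩ = (1 / k!) ∑ g^{i₁ j₁} ⋯ g^{i_k j_k} α_{i₁ … i_k} conj(β_{j₁ … j_k})`. -/
noncomputable def innerAt {n k : ℕ} (g : Cn n →L[ℝ] Cn n →L[ℝ] ℝ) (α β : Alt n k) : ℂ :=
  ((k.factorial : ℂ))⁻¹ * ∑ I : Fin k → Fin (2 * n), ∑ J : Fin k → Fin (2 * n),
    ((∏ s, (gram g)⁻¹ (I s) (J s) : ℝ) : ℂ) *
      (α (fun s => frame n (I s)) * (starRingEnd ℂ) (β (fun s => frame n (J s))))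

/-- Insertion of the vectors `u` into the first slots of an alternating map. -/
noncomputable def insertFirst {n : ℕ} {κ ι : Type*} (α : (Cn n) [⋀^κ ⊕ ι]→ₗ[ℝ] ℂ) (u : κ → Cn n) :
    (Cn n) [⋀^ι]→ₗ[ℝ] ℂ where
  toFun v := α (Sum.elim u v)
  map_update_add' v i x y := by
    classical
    have h := α.map_update_add (Sum.elim u v) (Sum.inr i) x y
    simp only [Sum.update_elim_inr] at h
    convert h
  map_update_smul' v i c x := by
    classical
    have h := α.map_update_smul (Sum.elim u v) (Sum.inr i) c x
    simp only [Sum.update_elim_inr] at h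
    convert h
  map_eq_zero_of_eq' v i j hv hij :=
    α.map_eq_zero_of_eq (i := Sum.inr i) (j := Sum.inr j) _ (by simpa using hv)
      (fun h => hij (Sum.inr.inj h))

/-- The conjugate linear Hodge star of a `k`-form, `k + l = 2n`, characterized by
`α ∧ ⋆β = ⟨α, β⟩ vol`:
`(⋆β)(v) = (1 / k!) ∑ g^{i₁ j₁} ⋯ g^{i_k j_k} conj(β_{i₁ … i_k}) vol(e_{j₁}, …, e_{j_k}, v)`. -/
noncomputable def starAt {n k l : ℕ} (h : k + l = 2 * n) (g : Cn n →L[ℝ] Cn n →L[ℝ] ℝ)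
    (β : Alt n k) : Alt n l :=
  ((k.factorial : ℂ))⁻¹ • ∑ I : Fin k → Fin (2 * n), ∑ J : Fin k → Fin (2 * n),
    (((∏ s, (gram g)⁻¹ (I s) (J s) : ℝ) : ℂ) *
        (starRingEnd ℂ) (β (fun s => frame n (I s)))) •
      toAlt (insertFirst ((volAlg g).domDomCongr ((finCongr h.symm).trans finSumFinEquiv.symm))
        (fun s => frame n (J s)))

/-- The complex linear part `v ↦ (f v - i f (i v)) / 2` of a real linear map. -/
noncomputable def linPart {n k : ℕ} (f : Cn n →L[ℝ] Alt n k) : Cn n →L[ℝ] Alt n k :=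
  (1 / 2 : ℂ) • (f - Complex.I • f.comp
    (Complex.I • ContinuousLinearMap.id ℝ (Cn n) : Cn n →L[ℝ] Cn n))

/-- The conjugate linear part `v ↦ (f v + i f (i v)) / 2` of a real linear map. -/
noncomputable def antiPart {n k : ℕ} (f : Cn n →L[ℝ] Alt n k) : Cn n →L[ℝ] Alt n k :=
  (1 / 2 : ℂ) • (f + Complex.I • f.comp
    (Complex.I • ContinuousLinearMap.id ℝ (Cn n) : Cn n →L[ℝ] Cn n))

/-! ### Differential forms on a complex manifold

`X` is a complex manifold modelled on `ℂⁿ`. As everywhere in Mathlib, the (real) tangent space at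
`x` is the model space `ℂⁿ`, the identification being the derivative of the preferred chart
`chartAt x` at `x`; as the charts are holomorphic, the almost complex structure of `X` is
multiplication by `i`. -/

section Manifold

variable {n : ℕ} {X : Type*} [TopologicalSpace X] [ChartedSpace (Cn n) X]

/-- A complex manifold is a real analytic manifold. -/
instance realManifold [IsManifold 𝓘(ℂ, Cn n) ω X] (m : ℕ∞ω) : IsManifold 𝓘(ℝ, Cn n) m X := by
  have : IsManifold 𝓘(ℝ, Cn n) ω X := by
    refine isManifold_of_contDiffOn 𝓘(ℝ, Cn n) ω X fun e e' he he' => ?_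
    have h := (contDiffGroupoid ω 𝓘(ℂ, Cn n)).compatible he he'
    rw [contDiffGroupoid, mem_groupoid_of_pregroupoid] at h
    exact ContDiffOn.restrict_scalars ℝ h.1
  exact IsManifold.of_le le_top

variable (n X) in
/-- Complex valued differential `k`-forms, not necessarily smooth. -/
abbrev Form (k : ℕ) : Type _ := X → Alt n k

variable (n X) in
/-- Inhomogeneous differential forms: the sum of the spaces of forms of all degrees `k`. (Forms of
degree `k > 2n` vanish, so that the product over all `k` is the direct sum.) -/
abbrev TotalForm : Type _ := ∀ k : ℕ, Form n X k

/-- The expression of a differential form in the chart `e`: its pullback under `e.symm`. -/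
noncomputable def inChart {k : ℕ} (e : OpenPartialHomeomorph X (Cn n)) (a : Form n X k) (y : Cn n) :
    Alt n k :=
  (a (e.symm y)).compContinuousLinearMap
    (mfderiv 𝓘(ℝ, Cn n) 𝓘(ℝ, Cn n) e.symm y : Cn n →L[ℝ] Cn n)

/-- A form is smooth if its coefficients are smooth in all charts. -/
def IsSmoothForm {k : ℕ} (a : Form n X k) : Prop :=
  ∀ e ∈ atlas (Cn n) X, ContDiffOn ℝ ∞ (inChart e a) e.target

/-- The elements of `Ω^{*,*}(X)`: all homogeneous components are smooth. -/
def IsSmooth (a : TotalForm n X) : Prop := ∀ k, IsSmoothForm (a k)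

/-- The exterior derivative. -/
noncomputable def dForm {k : ℕ} (a : Form n X k) : Form n X (k + 1) := fun x =>
  extDeriv (inChart (chartAt (Cn n) x) a) (chartAt (Cn n) x x)

/-- The operator `∂`, in holomorphic coordinates `z`: `∂a = ∑ⱼ dzⱼ ∧ ∂a/∂zⱼ`, where the coefficients
of `a` with respect to the forms `dz_I ∧ dz̄_J` are differentiated. -/
noncomputable def delForm {k : ℕ} (a : Form n X k) : Form n X (k + 1) := fun x =>
  .alternatizeUncurryFin
    (linPart (fderiv ℝ (inChart (chartAt (Cn n) x) a) (chartAt (Cn n) x x)))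

/-- The operator `∂̄`, in holomorphic coordinates `z`: `∂̄a = ∑ⱼ dz̄ⱼ ∧ ∂a/∂z̄ⱼ`, where the
coefficients of `a` with respect to the forms `dz_I ∧ dz̄_J` are differentiated. -/
noncomputable def delbarForm {k : ℕ} (a : Form n X k) : Form n X (k + 1) := fun x =>
  .alternatizeUncurryFin
    (antiPart (fderiv ℝ (inChart (chartAt (Cn n) x) a) (chartAt (Cn n) x x)))

/-- `∂` on `Ω^{*,*}(X)`. -/
noncomputable def del (a : TotalForm n X) : TotalForm n X
  | 0 => 0
  | k + 1 => delForm (a k)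

/-- `∂̄` on `Ω^{*,*}(X)`. -/
noncomputable def delbar (a : TotalForm n X) : TotalForm n X
  | 0 => 0
  | k + 1 => delbarForm (a k)

/-- The wedge product on `Ω^{*,*}(X)`. -/
noncomputable def wedge (a b : TotalForm n X) : TotalForm n X := fun m x =>
  ∑ k : Fin (m + 1), castAt (Nat.add_sub_of_le (Nat.lt_succ_iff.1 k.2))
    (wedgeAt (a k x) (b (m - k) x))

/-- `a` is homogeneous of degree `d` for the `ℤ/2`-grading of `Ω^{*,*}(X)`. -/
def HasParity (d : ℕ) (a : TotalForm n X) : Prop := ∀ k : ℕ, k % 2 ≠ d % 2 → a k = 0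

end Manifold

/-! ### Kähler metrics -/

section Metric

variable (n : ℕ) (X : Type*) [TopologicalSpace X] [ChartedSpace (Cn n) X]
  [IsManifold 𝓘(ℂ, Cn n) ω X]

/-- A Hermitian metric: a smooth Riemannian metric for which multiplication by `i` is an
isometry. -/
structure HermitianMetric extends Bundle.ContMDiffRiemannianMetric 𝓘(ℝ, Cn n) ∞ (Cn n)
    (fun x : X => TangentSpace 𝓘(ℝ, Cn n) x) where
  inner_I (x : X) (v w : Cn n) :
    (inner x : Cn n →L[ℝ] Cn n →L[ℝ] ℝ) (Complex.I • v) (Complex.I • w) =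
      (inner x : Cn n →L[ℝ] Cn n →L[ℝ] ℝ) v w

variable {n X}

/-- The inner product on the tangent space at `x`. -/
def HermitianMetric.g (h : HermitianMetric n X) (x : X) : Cn n →L[ℝ] Cn n →L[ℝ] ℝ := h.inner x

/-- The fundamental form `ω(v, w) = g(i v, w)`. -/
noncomputable def HermitianMetric.fundamentalForm (h : HermitianMetric n X) : Form n X 2 := fun x =>
  toAlt
    { toFun := fun v => ((h.g x (Complex.I • v 0) (v 1) : ℝ) : ℂ)
      map_update_add' := by
        intro _ v i x y
        fin_cases i <;> simp [Function.update, smul_add]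
      map_update_smul' := by
        intro _ v i c x
        fin_cases i <;> simp [Function.update, smul_comm Complex.I c x]
      map_eq_zero_of_eq' := by
        intro v i j hv hij
        have h01 : v 0 = v 1 := by
          fin_cases i <;> fin_cases j <;> simp_all
        have h1 : h.g x (Complex.I • v 0) (Complex.I • Complex.I • v 0)
            = h.g x (v 0) (Complex.I • v 0) := h.inner_I x (v 0) (Complex.I • v 0)
        have h2 : h.g x (v 0) (Complex.I • v 0) = h.g x (Complex.I • v 0) (v 0) :=
          h.symm x (v 0) (Complex.I • v 0)
        have h3 : h.g x (Complex.I • v 0) (v 0) = 0 := by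
          rw [smul_smul, Complex.I_mul_I, neg_one_smul, map_neg] at h1
          linarith
        simp [← h01, h3] }

variable (n X) in
/-- A Kähler metric: a Hermitian metric whose fundamental form is closed. -/
structure KaehlerMetric extends HermitianMetric n X where
  closed : dForm toHermitianMetric.fundamentalForm = 0

/-- The conjugate linear Hodge star on `Ω^{*,*}(X)`, taking `k`-forms to `(2n - k)`-forms. -/
noncomputable def hodgeStar (h : KaehlerMetric n X) (a : TotalForm n X) : TotalForm n X := fun l x =>
  if hl : l ≤ 2 * n then starAt (Nat.sub_add_cancel hl) (h.g x) (a (2 * n - l) x) else 0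

/-- The operator `∂* = - ⋆ ∂ ⋆`. -/
noncomputable def delStar (h : KaehlerMetric n X) (a : TotalForm n X) : TotalForm n X :=
  -hodgeStar h (del (hodgeStar h a))

end Metric

/-! ### Integration -/

section Integration

variable (n : ℕ) (X : Type*) [TopologicalSpace X] [ChartedSpace (Cn n) X]
  [IsManifold 𝓘(ℂ, Cn n) ω X] [T2Space X] [CompactSpace X]

/-- A smooth partition of unity subordinate to the chart domains. -/
noncomputable def chartPartition : SmoothPartitionOfUnity X 𝓘(ℝ, Cn n) X univ :=
  (SmoothPartitionOfUnity.exists_isSubordinate_chartAt_source 𝓘(ℝ, Cn n) X).choose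

variable {n X}

/-- The integral of a form of top degree over `X`, oriented by its complex structure: with the
partition of unity `ρ`, the sum of the integrals of the `ρᵢ a` in the charts, where
`∫ f dx₁ ∧ dy₁ ∧ ⋯ ∧ dx_n ∧ dy_n` is the Lebesgue integral of `f`. -/
noncomputable def integralTop (a : Form n X (2 * n)) : ℂ :=
  ∑ᶠ i : X, ∫ y in (chartAt (Cn n) i).target,
    ((chartPartition n X i ((chartAt (Cn n) i).symm y) : ℝ) : ℂ) *
      inChart (chartAt (Cn n) i) a y (frame n)

/-- `∫_X` on `Ω^{*,*}(X)`: the integral of the component of top degree. -/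
noncomputable def intX (a : TotalForm n X) : ℂ := integralTop (a (2 * n))

/-- The Hermitian `L²` inner product `(a, b) = ∫_X ⟨a, b⟩ vol` on `Ω^{*,*}(X)`, for which forms of
different degrees are orthogonal. -/
noncomputable def innerL2 (h : KaehlerMetric n X) (a b : TotalForm n X) : ℂ :=
  integralTop fun x =>
    (∑ k ∈ Finset.range (2 * n + 1), innerAt (h.g x) (a k x) (b k x)) • volAt (h.g x)

end Integration

end KaehlerForms

open KaehlerForms

/-! The proof separates calculus from pointwise linear algebra.

The calculus is a Stokes theorem for `∂` and `∂̄` individually. Both have the form `D = ½ (d + c J*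
d (J⁻¹)*)`, with `c = -i` or `c = i`, so they are treated together and no decomposition into types
is needed. Holomorphic maps commute with `J`, so naturality of `d` gives `D` the same expression in
every chart (`derivWith_pullback`, `inChart_derivForm`). Once `a` is cut off by a partition of
unity, the top form `Da ∧ b + (-1)^k a ∧ Db`, evaluated on the constant real frame, is an
antisymmetrized sum of derivatives in constant directions of compactly supported functions
(`leibniz_antisymmetrized`), so its integral vanishes. Writing `ε` for the sign `(-1)^k` in degree
`k`, this says `∫ Da ∧ b = -∫ εa ∧ Db` (`intX_derivTotal_wedge`), which contains the identity for
`∂̄`.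

The linear algebra consists of `α ∧ ⋆β = ⟨α, β⟩ vol` (`wedge_starAt`) and `α ∧ γ = (-1)^k ⟨α, ⋆γ⟩
vol` (`wedge_eq_inner_starAt`), both computed in an orthonormal frame; the second takes the place of
a formula for `⋆⋆`. Together with Stokes they give `(∂a, b) = ∫ ∂a ∧ ⋆b = -∫ εa ∧ ∂⋆b = -(a, ⋆∂⋆b) =
(a, ∂*b)`.

The identity for `∂*` is then formal. For `a` of degree `d`, Hermitian symmetry and the adjunction
give `∫ ∂*a ∧ b = (-1)^(d+1) (∂*a, ⋆b) = (-1)^(d+1) (a, ∂⋆b) = (-1)^(d+1) ∫ a ∧ ⋆∂⋆b = (-1)^d ∫ a ∧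
∂*b`.

What remains is that `⋆` preserves smoothness and that integrals do not depend on the chart; both
rest on transition maps being holomorphic, hence of positive real Jacobian. -/

namespace KaehlerForms

/-! ### Sums over permutations -/

/-- A sum over all self maps of a finite type reduces to the permutations if the summand vanishes
on maps that are not injective. -/
theorem sum_eq_sum_perm {ι M : Type*} [Fintype ι] [DecidableEq ι] [AddCommMonoid M]
    (T : (ι → ι) → M) (hT : ∀ f, ¬ Function.Injective f → T f = 0) :
    ∑ f : ι → ι, T f = ∑ σ : Equiv.Perm ι, T σ := by
  symm
  refine Finset.sum_of_injOn (fun σ : Equiv.Perm ι => (σ : ι → ι)) ?_ ?_ ?_ ?_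
  · intro σ _ τ _ h
    exact DFunLike.coe_injective h
  · intro σ _
    simp
  · intro f _ hf
    refine hT f fun hinj => hf ⟨Equiv.ofBijective f (Finite.injective_iff_bijective.1 hinj), ?_⟩
    simp
  · intro σ _
    rfl

theorem map_comp_eq_zero {n : ℕ} {κ ι : Type*} (η : (Cn n) [⋀^κ]→ₗ[ℝ] ℂ)
    (x : ι → Cn n) {f : κ → ι} (hf : ¬ Function.Injective f) : η (fun i => x (f i)) = 0 := by
  obtain ⟨i, j, hij, hne⟩ : ∃ i j, f i = f j ∧ i ≠ j := by
    simpa [Function.Injective] using hf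
  exact η.map_eq_zero_of_eq _ (by simp [hij]) hne

theorem sign_mul_sign {ι : Type*} [Fintype ι] [DecidableEq ι] (σ : Equiv.Perm ι) :
    ((Equiv.Perm.sign σ : ℤ) : ℂ) * ((Equiv.Perm.sign σ : ℤ) : ℂ) = 1 := by
  rw [← Int.cast_mul, ← Units.val_mul, Int.units_mul_self]
  simp

theorem map_perm' {n : ℕ} {ι : Type*} [Fintype ι] [DecidableEq ι] (η : (Cn n) [⋀^ι]→ₗ[ℝ] ℂ)
    (x : ι → Cn n) (σ : Equiv.Perm ι) :
    η (fun i => x (σ i)) = ((Equiv.Perm.sign σ : ℤ) : ℂ) * η x := by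
  have := η.map_perm x σ
  rw [Function.comp_def] at this
  rw [this, Units.smul_def, zsmul_eq_mul]

/-! ### Contracting alternating maps over one block of slots. -/

section Contraction

variable {n : ℕ} {κ ι : Type*} [Fintype κ] [DecidableEq κ] [Fintype ι] [DecidableEq ι]

/-- Contraction of a top degree form with a form on the first slots. -/
theorem sum_contract (β : (Cn n) [⋀^κ]→ₗ[ℝ] ℂ) (η : (Cn n) [⋀^κ ⊕ ι]→ₗ[ℝ] ℂ)
    (x : κ ⊕ ι → Cn n) :
    ∑ K : κ → κ ⊕ ι, β (fun i => x (K i)) *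
        η (fun s => x (Sum.elim K Sum.inr s)) =
      ((Fintype.card κ).factorial : ℂ) * (β (fun i => x (Sum.inl i)) * η x) := by
  -- A map `K` contributes only if it permutes the first block: a repeated index, or one from the
  -- second block, repeats an argument of `η`. For such `K` the signs from `β` and `η` cancel.
  have key : ∑ τ : Equiv.Perm κ, β (fun i => x (Sum.inl i)) * η x =
      ∑ K : κ → κ ⊕ ι, β (fun i => x (K i)) * η (fun s => x (Sum.elim K Sum.inr s)) := by
    refine Finset.sum_of_injOn (fun (τ : Equiv.Perm κ) (i : κ) => (Sum.inl (τ i) : κ ⊕ ι))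
      ?_ ?_ ?_ ?_
    · intro σ _ τ _ h
      ext i
      exact Sum.inl_injective (congrFun h i)
    · intro σ _
      simp
    · intro K _ hK
      rw [map_comp_eq_zero η x, mul_zero]
      intro hinj
      have h1 : ∀ i, ∃ j, K i = Sum.inl j := by
        intro i
        rcases hKi : K i with j | j
        · exact ⟨j, rfl⟩
        · have := @hinj (Sum.inl i) (Sum.inr j) (by simp [hKi])
          simp at this
      choose τ hτ using h1
      have hτi : Function.Injective τ := by
        intro i j hij
        exact Sum.inl_injective (@hinj (Sum.inl i) (Sum.inl j) (by simp [hτ, hij]))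
      refine hK ⟨Equiv.ofBijective τ (Finite.injective_iff_bijective.1 hτi), by simp, ?_⟩
      funext i
      simp [hτ]
    · intro τ _
      have h1 := map_perm' β (fun i => x (Sum.inl i)) τ
      have h2 := map_perm' η x (Equiv.sumCongr τ (Equiv.refl ι))
      have h3 : (fun s => x (Sum.elim (fun i => (Sum.inl (τ i) : κ ⊕ ι)) Sum.inr s)) =
          fun s => x (Equiv.sumCongr τ (Equiv.refl ι) s) := by
        funext s
        rcases s with s | s <;> simp
      rw [h3, h2, h1]
      have h4 : Equiv.Perm.sign (Equiv.sumCongr τ (Equiv.refl ι)) = Equiv.Perm.sign τ := by simp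
      rw [h4]
      linear_combination (-(β fun i => x (Sum.inl i)) * η x) * sign_mul_sign τ
  rw [← key]
  simp [Fintype.card_perm]

omit [DecidableEq κ] [DecidableEq ι] in
/-- An injective map out of a summand extends to a permutation of the sum. -/
theorem exists_perm_extend {K : κ → κ ⊕ ι} (hK : Function.Injective K) :
    ∃ σ : Equiv.Perm (κ ⊕ ι), ∀ i, σ (Sum.inl i) = K i := by
  obtain ⟨g, hg⟩ := Set.MapsTo.exists_equiv_extend_of_card_eq (α := κ ⊕ ι) (β := κ ⊕ ι)
    (t := Finset.univ) (by simp) (s := Set.range Sum.inl) (f := Sum.elim K Sum.inr)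
    (by intro i _; simp)
    (by
      rintro _ ⟨i, rfl⟩ _ ⟨j, rfl⟩ h
      have hij : i = j := hK (by simpa using h)
      rw [hij])
  refine ⟨g.trans (Equiv.subtypeUnivEquiv (by simp)), fun i => ?_⟩
  simpa using hg (Sum.inl i) ⟨i, rfl⟩

/-- Each injective `K` has `(card ι)!` completions to a permutation, and squaring removes their
signs. It is `sum_contract` with the blocks exchanged, applied to `η` and to `η` with its first
block already filled by `K`. -/
theorem sum_sq_of_injective (η : (Cn n) [⋀^κ ⊕ ι]→ₗ[ℝ] ℂ) (x : κ ⊕ ι → Cn n)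
    {K : κ → κ ⊕ ι} (hK : Function.Injective K) :
    ∑ L : ι → κ ⊕ ι, η (fun s => x (Sum.elim K L s)) ^ 2 =
      ((Fintype.card ι).factorial : ℂ) * η x ^ 2 := by
  obtain ⟨σ, hσ⟩ := exists_perm_extend hK
  have h := sum_contract (insertFirst η fun i => x (σ (Sum.inl i)))
    (η.domDomCongr (Equiv.sumComm κ ι)) (fun s => x (σ (Equiv.sumComm ι κ s)))
  have hx : η (fun s => x (σ s)) ^ 2 = η x ^ 2 := by
    rw [map_perm']
    linear_combination η x ^ 2 * sign_mul_sign σ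
  rw [← hx]
  rw [← (Equiv.arrowCongr (Equiv.refl ι) ((Equiv.sumComm ι κ).trans σ)).sum_comp]
  convert h using 1
  · refine Finset.sum_congr rfl fun L _ => ?_
    simp only [AlternatingMap.domDomCongr_apply, insertFirst, AlternatingMap.coe_mk,
      MultilinearMap.coe_mk]
    rw [sq]
    congr 2 <;>
    · funext s
      rcases s with s | s <;> simp [hσ]
  · simp only [AlternatingMap.domDomCongr_apply, insertFirst, AlternatingMap.coe_mk,
      MultilinearMap.coe_mk]
    rw [sq]
    congr 3 <;>
    · funext s
      rcases s with s | s <;> simp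

end Contraction

/-! ### Evaluation of the algebraic operations -/

variable {n k l m : ℕ}

/-- The identification of index sets used in the wedge product. -/
def sumIdx (h : k + l = m) : Fin k ⊕ Fin l ≃ Fin m := finSumFinEquiv.trans (finCongr h)

/-- Every shuffle stands for `k! l!` permutations. The sum over the full symmetric group can be
reindexed freely, so later identities are proved in this form and the nonzero factorials cancelled.
-/
theorem wedge_apply (h : k + l = m) (α : Alt n k) (β : Alt n l) (v : Fin m → Cn n) :
    (k.factorial * l.factorial : ℂ) * castAt h (wedgeAt α β) v =
      ∑ σ : Equiv.Perm (Fin k ⊕ Fin l), ((Equiv.Perm.sign σ : ℤ) : ℂ) *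
        (α (fun i => v (sumIdx h (σ (Sum.inl i)))) *
          β (fun j => v (sumIdx h (σ (Sum.inr j))))) := by
  have h1 := congrArg (fun F => LinearMap.mul' ℝ ℂ (F fun s => v (sumIdx h s)))
    (MultilinearMap.domCoprod_alternization_eq α.toAlternatingMap β.toAlternatingMap)
  simp only [MultilinearMap.alternatization_apply, map_sum] at h1
  rw [AlternatingMap.smul_apply, map_nsmul, nsmul_eq_mul, Nat.cast_mul, Fintype.card_fin,
    Fintype.card_fin] at h1
  refine Eq.trans h1.symm (Finset.sum_congr rfl fun σ _ => ?_)
  rw [Units.smul_def, map_zsmul, zsmul_eq_mul]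
  rfl

/-- The frame with coefficient matrix `P` with respect to the standard real frame. -/
noncomputable def frameOf (P : Matrix (Fin (2 * n)) (Fin (2 * n)) ℝ) (j : Fin (2 * n)) : Cn n :=
  ∑ i, P i j • frame n i

theorem map_frameOf {κ : Type*} [Fintype κ] [DecidableEq κ] (α : (Cn n) [⋀^κ]→ₗ[ℝ] ℂ)
    (P : Matrix (Fin (2 * n)) (Fin (2 * n)) ℝ) (M : κ → Fin (2 * n)) :
    α (fun s => frameOf P (M s)) =
      ∑ I : κ → Fin (2 * n), ((∏ s, P (I s) (M s) : ℝ) : ℂ) * α (fun s => frame n (I s)) := by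
  have h := α.toMultilinearMap.map_sum (fun (s : κ) (i : Fin (2 * n)) => P i (M s) • frame n i)
  refine Eq.trans h (Finset.sum_congr rfl fun I _ => ?_)
  have h2 := α.toMultilinearMap.map_smul_univ (fun s => P (I s) (M s)) (fun s => frame n (I s))
  refine Eq.trans h2 ?_
  rw [Complex.real_smul]
  rfl

/-- Expanding the product over the slots of the entries of `P * Pᵀ` introduces one intermediate
multi-index `M`, after which the sums over `I` and `J` separate. This turns contraction with the
inverse metric into a sum over a frame. -/
theorem sum_gram_inv (P : Matrix (Fin (2 * n)) (Fin (2 * n)) ℝ)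
    (a b : (Fin k → Fin (2 * n)) → ℂ) :
    ∑ I : Fin k → Fin (2 * n), ∑ J : Fin k → Fin (2 * n),
        ((∏ s, (P * P.transpose) (I s) (J s) : ℝ) : ℂ) * (a I * b J) =
      ∑ M : Fin k → Fin (2 * n), (∑ I : Fin k → Fin (2 * n),
          ((∏ s, P (I s) (M s) : ℝ) : ℂ) * a I) *
        ∑ J : Fin k → Fin (2 * n), ((∏ s, P (J s) (M s) : ℝ) : ℂ) * b J := by
  have h1 : ∀ I J : Fin k → Fin (2 * n), ((∏ s, (P * P.transpose) (I s) (J s) : ℝ) : ℂ) =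
      ∑ M : Fin k → Fin (2 * n), ((∏ s, P (I s) (M s) : ℝ) : ℂ) *
        ((∏ s, P (J s) (M s) : ℝ) : ℂ) := by
    intro I J
    simp only [Matrix.mul_apply, Matrix.transpose_apply]
    rw [Finset.prod_univ_sum, Fintype.piFinset_univ]
    simp [Finset.prod_mul_distrib]
  simp only [h1, Finset.sum_mul, Finset.mul_sum]
  rw [Finset.sum_congr rfl fun I _ => Finset.sum_comm, Finset.sum_comm]
  refine Finset.sum_congr rfl fun M _ => Finset.sum_comm.trans ?_
  refine Finset.sum_congr rfl fun I _ => Finset.sum_congr rfl fun J _ => ?_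
  ring

/-- Composition of an alternating map with complex conjugation. -/
noncomputable def conjAlt {κ : Type*} (α : (Cn n) [⋀^κ]→ₗ[ℝ] ℂ) : (Cn n) [⋀^κ]→ₗ[ℝ] ℂ :=
  Complex.conjAe.toLinearMap.compAlternatingMap α

@[simp] theorem conjAlt_apply {κ : Type*} (α : (Cn n) [⋀^κ]→ₗ[ℝ] ℂ) (v : κ → Cn n) :
    conjAlt α v = (starRingEnd ℂ) (α v) := rfl

/-! ### Inner product and star in a frame `P` with `g⁻¹ = P Pᵀ`, which is orthonormal when `g` is
nondegenerate. -/

section OrthonormalFrame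

variable {g : Cn n →L[ℝ] Cn n →L[ℝ] ℝ} {P : Matrix (Fin (2 * n)) (Fin (2 * n)) ℝ}

theorem innerAt_eq_sum (hP : (gram g)⁻¹ = P * P.transpose) (α β : Alt n k) :
    innerAt g α β = (k.factorial : ℂ)⁻¹ * ∑ M : Fin k → Fin (2 * n),
      α (fun s => frameOf P (M s)) * (starRingEnd ℂ) (β (fun s => frameOf P (M s))) := by
  rw [innerAt, hP, sum_gram_inv P (fun I => α (fun s => frame n (I s)))
    (fun J => (starRingEnd ℂ) (β (fun s => frame n (J s))))]
  congr 1
  refine Finset.sum_congr rfl fun M _ => ?_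
  exact congrArg₂ (· * ·) (map_frameOf α.toAlternatingMap P M).symm
    (map_frameOf (conjAlt β.toAlternatingMap) P M).symm

theorem starAt_apply (h : k + l = 2 * n) (g : Cn n →L[ℝ] Cn n →L[ℝ] ℝ) (β : Alt n k)
    (v : Fin l → Cn n) :
    starAt h g β v = (k.factorial : ℂ)⁻¹ * ∑ I : Fin k → Fin (2 * n), ∑ J : Fin k → Fin (2 * n),
      (((∏ s, (gram g)⁻¹ (I s) (J s) : ℝ) : ℂ) * ((starRingEnd ℂ) (β (fun s => frame n (I s))) *
        volAlg g (fun j => Sum.elim (fun s => frame n (J s)) v ((sumIdx h).symm j)))) := by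
  simp only [starAt, ContinuousAlternatingMap.smul_apply, smul_eq_mul,
    ContinuousAlternatingMap.sum_apply, mul_assoc]
  rfl

theorem starAt_eq_sum (h : k + l = 2 * n) (hP : (gram g)⁻¹ = P * P.transpose) (β : Alt n k)
    (v : Fin l → Cn n) :
    starAt h g β v = (k.factorial : ℂ)⁻¹ * ∑ M : Fin k → Fin (2 * n),
      (starRingEnd ℂ) (β (fun s => frameOf P (M s))) *
        volAlg g (fun j => Sum.elim (fun s => frameOf P (M s)) v ((sumIdx h).symm j)) := by
  rw [starAt_apply, hP]
  have h1 := sum_gram_inv P (fun I => (starRingEnd ℂ) (β (fun s => frame n (I s))))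
    (fun J => volAlg g (fun j => Sum.elim (fun s => frame n (J s)) v ((sumIdx h).symm j)))
  rw [h1]
  congr 1
  refine Finset.sum_congr rfl fun M _ => ?_
  congr 1
  · exact (map_frameOf (conjAlt β.toAlternatingMap) P M).symm
  -- With `v` fixed, `vol` is an alternating map of the other `k` arguments and can be expanded in
  -- them; the blocks are swapped because `insertFirst` fills the first one.
  · have h2 := map_frameOf (insertFirst
      (((volAlg g).domDomCongr (sumIdx h).symm).domDomCongr (Equiv.sumComm _ _)) v |>.domDomCongr
        (Equiv.refl _)) P M
    have h3 : ∀ w : Fin k → Cn n, (insertFirst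
      (((volAlg g).domDomCongr (sumIdx h).symm).domDomCongr (Equiv.sumComm _ _)) v |>.domDomCongr
        (Equiv.refl _)) w = volAlg g (fun j => Sum.elim w v ((sumIdx h).symm j)) := by
      intro w
      simp only [AlternatingMap.domDomCongr_apply, insertFirst, AlternatingMap.coe_mk,
        MultilinearMap.coe_mk]
      congr 1
      funext j
      rcases hj : (sumIdx h).symm j with s | s <;> simp [hj]
    simp only [h3] at h2
    exact h2.symm

theorem innerAt_conj_symm (hP : (gram g)⁻¹ = P * P.transpose) (α β : Alt n k) :
    innerAt g β α = (starRingEnd ℂ) (innerAt g α β) := by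
  rw [innerAt_eq_sum hP, innerAt_eq_sum hP, map_mul, map_sum]
  simp [mul_comm]

end OrthonormalFrame

end KaehlerForms

namespace KaehlerForms

variable {n k l m : ℕ}

/-! ### Forms of top degree -/

theorem realCoords_frame (j : Fin (2 * n)) : realCoords n (frame n j) = Pi.single j 1 := by
  funext i
  simp only [realCoords, frame, LinearMap.coe_mk, AddHom.coe_mk, Pi.single_apply, Fin.mk.injEq]
  by_cases hij : i = j
  · subst hij
    by_cases h : (i : ℕ) % 2 = 0 <;> simp [h]
  · have hne : (i : ℕ) ≠ j := fun h => hij (Fin.ext h)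
    by_cases h : (i : ℕ) % 2 = 0 <;> by_cases h' : (j : ℕ) % 2 = 0 <;>
      by_cases h2 : (i : ℕ) / 2 = (j : ℕ) / 2 <;> simp [h, h', h2, hij] <;> omega

theorem sum_realCoords_smul_frame (z : Cn n) : ∑ j, realCoords n z j • frame n j = z := by
  have hinj : Function.Injective (realCoords n) := by
    rw [← LinearMap.ker_eq_bot, LinearMap.ker_eq_bot']
    intro w hw
    funext i
    have h0 := congrFun hw ⟨2 * i, by omega⟩
    have h1 := congrFun hw ⟨2 * i + 1, by omega⟩
    have h2 : (2 * (i : ℕ) + 1) % 2 = 1 := by omega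
    have h3 : (2 * (i : ℕ) + 1) / 2 = i := by omega
    simp only [realCoords, LinearMap.coe_mk, AddHom.coe_mk] at h0 h1
    simp [h2, h3] at h0 h1
    exact Complex.ext h0 h1
  apply hinj
  simp only [map_sum, map_smul, realCoords_frame]
  funext i
  simp [Pi.single_apply]

/-- The real frame as a basis. -/
noncomputable def frameBasis (n : ℕ) : Module.Basis (Fin (2 * n)) ℝ (Cn n) :=
  Module.Basis.ofEquivFun
    { realCoords n with
      invFun := fun w => ∑ j, w j • frame n j
      left_inv := fun z => sum_realCoords_smul_frame z
      right_inv := fun w => by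
        change realCoords n _ = w
        simp only [map_sum, map_smul, realCoords_frame]
        funext i
        simp [Pi.single_apply] }

@[simp] theorem frameBasis_apply (j : Fin (2 * n)) : frameBasis n j = frame n j := by
  rw [frameBasis, Module.Basis.coe_ofEquivFun]
  change ∑ i, (Pi.single j (1 : ℝ) : Fin (2 * n) → ℝ) i • frame n i = frame n j
  simp [Pi.single_apply]

@[simp] theorem frameBasis_repr (z : Cn n) (j : Fin (2 * n)) :
    (frameBasis n).repr z j = realCoords n z j := rfl

/-- Top forms are a line: an alternating map is determined by its values on injective families of
basis vectors, which here are the permutations of the frame. -/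
theorem topForm_apply (η : (Cn n) [⋀^Fin (2 * n)]→ₗ[ℝ] ℂ) (v : Fin (2 * n) → Cn n) :
    η v = ((Matrix.of fun i => realCoords n (v i)).det : ℂ) * η (frame n) := by
  have h : η = (LinearMap.toSpanSingleton ℝ ℂ (η (frame n))).compAlternatingMap
      (Matrix.detRowAlternating.compLinearMap (realCoords n)) := by
    refine Module.Basis.ext_alternating (frameBasis n) fun w hw => ?_
    obtain ⟨σ, rfl⟩ : ∃ σ : Equiv.Perm (Fin (2 * n)), w = σ :=
      ⟨Equiv.ofBijective w (Finite.injective_iff_bijective.1 hw), by simp⟩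
    have h1 := η.map_perm (frame n) σ
    have h2 := (Matrix.detRowAlternating (n := Fin (2 * n)) (R := ℝ)).map_perm
      (fun i => realCoords n (frame n i)) σ
    have h3 : (Matrix.detRowAlternating (n := Fin (2 * n)) (R := ℝ))
        (fun i => realCoords n (frame n i)) = 1 := by
      have : (fun i => realCoords n (frame n i)) = (1 : Matrix (Fin (2 * n)) (Fin (2 * n)) ℝ) := by
        funext i j
        simp [realCoords_frame, Matrix.one_apply, Pi.single_apply, eq_comm]
      rw [this]
      exact Matrix.det_one
    simp only [frameBasis_apply, LinearMap.compAlternatingMap_apply,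
      AlternatingMap.compLinearMap_apply, LinearMap.toSpanSingleton_apply]
    simp only [Function.comp_def] at h1 h2
    refine h1.trans ?_
    erw [h2, h3]
    rcases Int.units_eq_one_or (Equiv.Perm.sign σ) with hs | hs <;> simp [hs]
  conv_lhs => rw [h]
  simp only [LinearMap.compAlternatingMap_apply, AlternatingMap.compLinearMap_apply,
    LinearMap.toSpanSingleton_apply, Complex.real_smul]
  rfl

theorem topForm_frameOf (η : (Cn n) [⋀^Fin (2 * n)]→ₗ[ℝ] ℂ)
    (P : Matrix (Fin (2 * n)) (Fin (2 * n)) ℝ) :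
    η (fun j => frameOf P j) = (P.det : ℂ) * η (frame n) := by
  rw [topForm_apply, ← Matrix.det_transpose P]
  congr 3
  funext i j
  simp [frameOf, realCoords_frame, Pi.single_apply, Matrix.transpose_apply]

theorem topForm_ext {P : Matrix (Fin (2 * n)) (Fin (2 * n)) ℝ} (hP : P.det ≠ 0)
    {η θ : Alt n (2 * n)} (h : η (fun j => frameOf P j) = θ (fun j => frameOf P j)) : η = θ := by
  have h1 := topForm_frameOf η.toAlternatingMap P
  have h2 := topForm_frameOf θ.toAlternatingMap P
  have h3 : η (frame n) = θ (frame n) := by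
    have hP' : (P.det : ℂ) ≠ 0 := by exact_mod_cast hP
    exact mul_left_cancel₀ hP' (h1.symm.trans (h.trans h2))
  ext v
  refine (topForm_apply η.toAlternatingMap v).trans (Eq.trans ?_
    (topForm_apply θ.toAlternatingMap v).symm)
  exact congrArg _ h3

@[simp] theorem volAlg_frame (g : Cn n →L[ℝ] Cn n →L[ℝ] ℝ) :
    volAlg g (frame n) = (Real.sqrt (gram g).det : ℂ) := by
  have : (fun i => realCoords n (frame n i)) = (1 : Matrix (Fin (2 * n)) (Fin (2 * n)) ℝ) := by
    funext i j
    simp [realCoords_frame, Matrix.one_apply, Pi.single_apply, eq_comm]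
  have h : (Matrix.detRowAlternating (n := Fin (2 * n)) (R := ℝ))
      (fun i => realCoords n (frame n i)) = 1 := by
    rw [this]
    exact Matrix.det_one
  have h2 : volAlg g (frame n) = Real.sqrt (gram g).det •
      (((Matrix.detRowAlternating (n := Fin (2 * n)) (R := ℝ))
      (fun i => realCoords n (frame n i)) : ℝ) : ℂ) := rfl
  rw [h2, h]
  simp

theorem volAlg_conj (g : Cn n →L[ℝ] Cn n →L[ℝ] ℝ) (v : Fin (2 * n) → Cn n) :
    (starRingEnd ℂ) (volAlg g v) = volAlg g v := by
  rw [topForm_apply, volAlg_frame, map_mul, Complex.conj_ofReal, Complex.conj_ofReal]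

/-! ### Orthonormal frames -/

/-- The Gram matrix is positive definite because the frame is independent, so its inverse has a
positive square root; that root is symmetric and serves as `P`. -/
theorem exists_orthonormal_frame {g : Cn n →L[ℝ] Cn n →L[ℝ] ℝ} (hs : ∀ v w, g v w = g w v)
    (hp : ∀ v, v ≠ 0 → 0 < g v v) :
    0 < (gram g).det ∧ ∃ P, (gram g)⁻¹ = P * P.transpose := by
  have hpos : (gram g).PosDef := by
    refine Matrix.PosDef.of_dotProduct_mulVec_pos ?_ ?_
    · ext i j
      simp [gram, hs (frame n j) (frame n i)]
    · intro x hx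
      have h1 : star x ⬝ᵥ (gram g).mulVec x = g (∑ i, x i • frame n i) (∑ i, x i • frame n i) := by
        simp only [dotProduct, Matrix.mulVec, gram, Matrix.of_apply, map_sum, map_smul,
          sum_apply, smul_apply, smul_eq_mul,
          Pi.star_apply, star_trivial, Finset.mul_sum]
        refine Finset.sum_comm.trans (Finset.sum_congr rfl fun i _ =>
          Finset.sum_congr rfl fun j _ => ?_)
        ring
      rw [h1]
      refine hp _ fun h0 => hx ?_
      have h2 := congrArg (realCoords n) h0
      simp only [map_sum, map_smul, realCoords_frame, map_zero] at h2
      funext i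
      simpa [Pi.single_apply] using congrFun h2 i
  refine ⟨hpos.det_pos, ?_⟩
  open scoped MatrixOrder in
  have hn : 0 ≤ (gram g)⁻¹ := hpos.inv.posSemidef.nonneg
  refine ⟨CFC.sqrt (gram g)⁻¹, ?_⟩
  have hsym : (CFC.sqrt (gram g)⁻¹).transpose = CFC.sqrt (gram g)⁻¹ := by
    have := (Matrix.nonneg_iff_posSemidef.1 (CFC.sqrt_nonneg (gram g)⁻¹)).isHermitian
    simpa [Matrix.IsHermitian] using this
  rw [hsym, CFC.sqrt_mul_sqrt_self _ hn]

/-- Taking determinants in `g⁻¹ = P Pᵀ` gives `(det P)² det g = 1`. Only the square is controlled,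
since `P` need not be positively oriented; the identities below use `vol` on the frame only through
`v ^ 2 = 1`. -/
theorem volAlg_frameOf_sq {g : Cn n →L[ℝ] Cn n →L[ℝ] ℝ}
    {P : Matrix (Fin (2 * n)) (Fin (2 * n)) ℝ} (hd : 0 < (gram g).det)
    (hP : (gram g)⁻¹ = P * P.transpose) :
    volAlg g (fun j => frameOf P j) ^ 2 = 1 := by
  rw [topForm_frameOf, volAlg_frame]
  have h1 := congrArg Matrix.det hP
  rw [Matrix.det_nonsing_inv, Ring.inverse_eq_inv, Matrix.det_mul, Matrix.det_transpose] at h1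
  have h2 : (P.det * Real.sqrt (gram g).det) ^ 2 = 1 := by
    rw [mul_pow, Real.sq_sqrt hd.le, sq, ← h1, inv_mul_cancel₀ hd.ne']
  exact_mod_cast h2

/-! ### The pointwise Hodge star identities. -/

section Star

variable {g : Cn n →L[ℝ] Cn n →L[ℝ] ℝ} {P : Matrix (Fin (2 * n)) (Fin (2 * n)) ℝ}

theorem det_ne_zero_of_inv_eq (hd : 0 < (gram g).det) (hP : (gram g)⁻¹ = P * P.transpose) :
    P.det ≠ 0 := by
  intro h0
  have h1 := congrArg Matrix.det hP
  rw [Matrix.det_nonsing_inv, Ring.inverse_eq_inv, Matrix.det_mul, h0, zero_mul] at h1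
  exact hd.ne' (inv_eq_zero.1 h1)

/-- On part of an orthonormal frame, `⋆β` sees only the complementary frame vectors: all other terms
repeat an argument of `vol`, and `sum_contract` collects the survivors into `k!` equal ones. -/
theorem starAt_frameOf (h : k + l = 2 * n) (hP : (gram g)⁻¹ = P * P.transpose) (β : Alt n k)
    (σ : Equiv.Perm (Fin k ⊕ Fin l)) :
    starAt h g β (fun j => frameOf P (sumIdx h (σ (Sum.inr j)))) =
      (starRingEnd ℂ) (β (fun i => frameOf P (sumIdx h (σ (Sum.inl i))))) *
        (((Equiv.Perm.sign σ : ℤ) : ℂ) * volAlg g (fun j => frameOf P j)) := by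
  have h1 := sum_contract (conjAlt β.toAlternatingMap)
    ((volAlg g).domDomCongr (sumIdx h).symm) (fun s => frameOf P (sumIdx h (σ s)))
  have h2 := map_perm' ((volAlg g).domDomCongr (sumIdx h).symm)
    (fun s => frameOf P (sumIdx h s)) σ
  have h3 : ((volAlg g).domDomCongr (sumIdx h).symm) (fun s => frameOf P (sumIdx h s)) =
      volAlg g (fun j => frameOf P j) := by
    simp [AlternatingMap.domDomCongr_apply, Function.comp_def]
  rw [h2, h3, Fintype.card_fin] at h1
  rw [starAt_eq_sum h hP, inv_mul_eq_iff_eq_mul₀ (by exact_mod_cast k.factorial_ne_zero)]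
  rw [← (Equiv.arrowCongr (Equiv.refl (Fin k)) (σ.trans (sumIdx h))).sum_comp]
  refine Eq.trans (Finset.sum_congr rfl fun K _ => ?_) h1
  simp only [AlternatingMap.domDomCongr_apply, conjAlt_apply]
  congr 2
  funext j
  rcases hj : (sumIdx h).symm j with s | s <;> simp [hj]

/-- The characterization `α ∧ ⋆β = ⟨α, β⟩ vol` of the Hodge star. -/
theorem wedge_starAt (h : k + l = 2 * n) (hd : 0 < (gram g).det)
    (hP : (gram g)⁻¹ = P * P.transpose) (α β : Alt n k) :
    castAt h (wedgeAt α (starAt h g β)) = innerAt g α β • volAt g := by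
  refine topForm_ext (det_ne_zero_of_inv_eq hd hP) ?_
  set v := volAlg g (fun j => frameOf P j) with hv
  have hv2 : v ^ 2 = 1 := volAlg_frameOf_sq hd hP
  set F : (Fin k → Fin k ⊕ Fin l) → ℂ := fun K =>
    α (fun i => frameOf P (sumIdx h (K i))) *
      (starRingEnd ℂ) (β (fun i => frameOf P (sumIdx h (K i)))) with hF
  have h1 : (k.factorial * l.factorial : ℂ) *
      castAt h (wedgeAt α (starAt h g β)) (fun j => frameOf P j) =
      v * ∑ σ : Equiv.Perm (Fin k ⊕ Fin l), F (fun i => σ (Sum.inl i)) := by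
    rw [wedge_apply, Finset.mul_sum]
    refine Finset.sum_congr rfl fun σ _ => ?_
    rw [starAt_frameOf h hP]
    linear_combination (v * F (fun i => σ (Sum.inl i))) * sign_mul_sign σ
  set V := (volAlg g).domDomCongr (sumIdx h).symm with hV
  have hVx : V (fun s => frameOf P (sumIdx h s)) = v := by
    simp [hV, hv, AlternatingMap.domDomCongr_apply, Function.comp_def]
  -- The summand depends only on the first block of `σ`. The weight `V ^ 2` is `1` on permutations
  -- and `0` on other self maps, so the sum extends to all maps and splits into pairs `(K, L)`; an
  -- injective `K` then has `l!` completions, and for the others `F K = 0`.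
  have h2 : ∑ σ : Equiv.Perm (Fin k ⊕ Fin l), F (fun i => σ (Sum.inl i)) =
      l.factorial * ∑ K, F K := by
    have e1 : ∑ σ : Equiv.Perm (Fin k ⊕ Fin l), F (fun i => σ (Sum.inl i)) =
        ∑ σ : Equiv.Perm (Fin k ⊕ Fin l), F (fun i => σ (Sum.inl i)) *
          V (fun s => frameOf P (sumIdx h (σ s))) ^ 2 := by
      refine Finset.sum_congr rfl fun σ _ => ?_
      have := map_perm' V (fun s => frameOf P (sumIdx h s)) σ
      rw [this, hVx]
      linear_combination (-F (fun i => σ (Sum.inl i)) * v ^ 2) * sign_mul_sign σ -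
        F (fun i => σ (Sum.inl i)) * hv2
    rw [e1, ← sum_eq_sum_perm (fun S : Fin k ⊕ Fin l → Fin k ⊕ Fin l =>
      F (fun i => S (Sum.inl i)) * V (fun s => frameOf P (sumIdx h (S s))) ^ 2)
      (fun S hS => by
        rw [map_comp_eq_zero V (fun s => frameOf P (sumIdx h s)) hS]
        ring)]
    rw [← (Equiv.sumArrowEquivProdArrow _ _ _).symm.sum_comp, Fintype.sum_prod_type,
      Finset.mul_sum]
    refine Finset.sum_congr rfl fun K _ => ?_
    by_cases hK : Function.Injective K
    · have := sum_sq_of_injective V (fun s => frameOf P (sumIdx h s)) hK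
      rw [hVx, hv2, Fintype.card_fin, mul_one] at this
      rw [← this, Finset.sum_mul]
      refine Finset.sum_congr rfl fun L _ => ?_
      rw [mul_comm]
      rfl
    · have hF0 : F K = 0 := by
        have := map_comp_eq_zero α.toAlternatingMap (fun s => frameOf P (sumIdx h s)) hK
        simp only [hF]
        exact mul_eq_zero_of_left this _
      rw [hF0, mul_zero]
      refine Finset.sum_eq_zero fun L _ => ?_
      exact mul_eq_zero_of_left hF0 _
  have h3 : (k.factorial : ℂ) * innerAt g α β = ∑ K, F K := by
    rw [innerAt_eq_sum hP, mul_inv_cancel_left₀ (by exact_mod_cast k.factorial_ne_zero),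
      ← (Equiv.arrowCongr (Equiv.refl (Fin k)) (sumIdx h)).sum_comp]
    rfl
  have hk : (k.factorial : ℂ) ≠ 0 := by exact_mod_cast k.factorial_ne_zero
  have hl : (l.factorial : ℂ) ≠ 0 := by exact_mod_cast l.factorial_ne_zero
  refine mul_left_cancel₀ (mul_ne_zero hk hl) (h1.trans ?_)
  rw [h2, ← h3]
  change _ = _ * (innerAt g α β * v)
  ring

theorem finRotate_pow_apply (N k : ℕ) (j : Fin (N + 1)) :
    ((finRotate (N + 1) ^ k) j : ℕ) = (j + k) % (N + 1) := by
  induction k with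
  | zero => simp [Nat.mod_eq_of_lt j.2]
  | succ k ih =>
    rw [pow_succ', Equiv.Perm.mul_apply, finRotate_apply, Fin.val_add, ih, ← add_assoc]
    simp

/-- Swapping the blocks is the rotation `j ↦ j + k` mod `m`, the `k`-th power of an `m`-cycle, which
is odd because `m` is even. Thus the usual sign `(-1)^(k l)` is simply `(-1)^k`. -/
theorem sign_blockSwap (hm : Even m) (h : k + l = m) (h' : l + k = m) :
    Equiv.Perm.sign (((sumIdx h').symm.trans (Equiv.sumComm _ _)).trans (sumIdx h)) =
      (-1) ^ k := by
  obtain _ | N := m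
  · obtain rfl : k = 0 := by omega
    rw [pow_zero, Subsingleton.elim (((sumIdx h').symm.trans (Equiv.sumComm _ _)).trans
      (sumIdx h)) (1 : Equiv.Perm (Fin 0)), Equiv.Perm.sign_one]
  · have hrot : ((sumIdx h').symm.trans (Equiv.sumComm _ _)).trans (sumIdx h) =
        finRotate (N + 1) ^ k := by
      ext j
      obtain ⟨s, rfl⟩ := (sumIdx h').surjective j
      rw [finRotate_pow_apply]
      rcases s with s | s
      · have : k + (s : ℕ) < N + 1 := by omega
        simp [sumIdx, add_comm _ k, Nat.mod_eq_of_lt this]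
      · have : l + (s : ℕ) + k = (N + 1) + s := by omega
        have hs : (s : ℕ) < N + 1 := by omega
        simp [sumIdx, this, Nat.mod_eq_of_lt hs]
    have hodd : (-1 : ℤˣ) ^ N = -1 := Odd.neg_one_pow (by grind)
    rw [hrot, map_pow, sign_finRotate, Nat.add_sub_cancel, hodd]

/-- The wedge product is up to sign the inner product with the Hodge star. -/
theorem wedge_eq_inner_starAt (h : k + l = 2 * n) (h' : l + k = 2 * n) (hd : 0 < (gram g).det)
    (hP : (gram g)⁻¹ = P * P.transpose) (α : Alt n k) (γ : Alt n l) :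
    castAt h (wedgeAt α γ) = ((-1) ^ k * innerAt g α (starAt h' g γ)) • volAt g := by
  refine topForm_ext (det_ne_zero_of_inv_eq hd hP) ?_
  set v := volAlg g (fun j => frameOf P j) with hv
  have hv2 : v ^ 2 = 1 := volAlg_frameOf_sq hd hP
  set V := (volAlg g).domDomCongr (sumIdx h).symm with hV
  have hVx : V (fun s => frameOf P (sumIdx h s)) = v := by
    simp [hV, hv, AlternatingMap.domDomCongr_apply, Function.comp_def]
  have hswap : ∀ w : Fin (2 * n) → Cn n,
      volAlg g (fun j => w (sumIdx h ((sumIdx h').symm j).swap)) = (-1) ^ k * volAlg g w := by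
    intro w
    have := map_perm' (volAlg g) w
      (((sumIdx h').symm.trans (Equiv.sumComm _ _)).trans (sumIdx h))
    rw [sign_blockSwap (even_two_mul n)] at this
    simpa using this
  have hk : (k.factorial : ℂ) ≠ 0 := by exact_mod_cast k.factorial_ne_zero
  have hl : (l.factorial : ℂ) ≠ 0 := by exact_mod_cast l.factorial_ne_zero
  -- The index `K` comes from the inner product and `L` from the star. The two conjugations of `γ`
  -- cancel and `vol` is real; in `⋆γ` the block of `γ` comes first, whence the block swap and
  -- `(-1)^k`.
  have h1 : (k.factorial * l.factorial : ℂ) * innerAt g α (starAt h' g γ) =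
      (-1) ^ k * ∑ S : Fin k ⊕ Fin l → Fin k ⊕ Fin l,
        α (fun i => frameOf P (sumIdx h (S (Sum.inl i)))) *
        γ (fun i => frameOf P (sumIdx h (S (Sum.inr i)))) *
        V (fun s => frameOf P (sumIdx h (S s))) := by
    rw [innerAt_eq_sum hP, ← (Equiv.sumArrowEquivProdArrow _ _ _).symm.sum_comp,
      Fintype.sum_prod_type, Finset.mul_sum,
      ← (Equiv.arrowCongr (Equiv.refl (Fin k)) (sumIdx h)).sum_comp, Finset.mul_sum,
      Finset.mul_sum]
    refine Finset.sum_congr rfl fun K _ => ?_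
    rw [starAt_eq_sum h' hP, ← (Equiv.arrowCongr (Equiv.refl (Fin l)) (sumIdx h)).sum_comp,
      map_mul, map_sum, Finset.mul_sum, Finset.mul_sum, Finset.mul_sum, Finset.mul_sum,
      Finset.mul_sum]
    refine Finset.sum_congr rfl fun L _ => ?_
    have h3 : volAlg g (fun j => Sum.elim (fun s => frameOf P (sumIdx h (L s)))
        (fun s => frameOf P (sumIdx h (K s))) ((sumIdx h').symm j)) =
        (-1) ^ k * V (fun s => frameOf P (sumIdx h (Sum.elim K L s))) := by
      rw [hV, AlternatingMap.domDomCongr_apply, ← hswap]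
      congr 1
      funext j
      rcases (sumIdx h').symm j with s | s <;> simp
    have h4 : ∀ i : Fin k ⊕ Fin l, (Equiv.sumArrowEquivProdArrow (Fin k) (Fin l) (Fin k ⊕ Fin l)).symm
      (K, L) i = Sum.elim K L i := fun i => rfl
    simp only [Equiv.arrowCongr_apply, Equiv.coe_refl, Function.comp_def, Equiv.refl_symm, id,
      h4, Sum.elim_inl, Sum.elim_inr] at h3 ⊢
    rw [h3]
    have h5 : (starRingEnd ℂ) (V (fun s => frameOf P (sumIdx h (Sum.elim K L s)))) =
      V (fun s => frameOf P (sumIdx h (Sum.elim K L s))) := volAlg_conj g _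
    simp only [map_mul, h5, map_pow, map_neg, map_one, map_inv₀, Complex.conj_conj, map_natCast]
    field_simp
  -- The factor `V` in `h1` kills the maps `S` that are not permutations and equals `sign σ * v` on
  -- a permutation, so multiplying the wedge by `v` makes the two sums agree.
  have h2 : (k.factorial * l.factorial : ℂ) * castAt h (wedgeAt α γ) (fun j => frameOf P j) * v =
      (-1) ^ k * ((k.factorial * l.factorial : ℂ) * innerAt g α (starAt h' g γ)) := by
    rw [h1, ← mul_assoc, ← mul_pow, neg_one_mul, neg_neg, one_pow, one_mul, sum_eq_sum_perm,
      wedge_apply, Finset.sum_mul]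
    · refine Finset.sum_congr rfl fun σ _ => ?_
      have := map_perm' V (fun s => frameOf P (sumIdx h s)) σ
      rw [this, hVx]
      ring
    · intro S hS
      rw [map_comp_eq_zero V (fun s => frameOf P (sumIdx h s)) hS, mul_zero]
  refine mul_left_cancel₀ (mul_ne_zero hk hl) ?_
  change _ = _ * ((-1) ^ k * innerAt g α (starAt h' g γ) * v)
  linear_combination v * h2 - (k.factorial * l.factorial : ℂ) *
    castAt h (wedgeAt α γ) (fun j => frameOf P j) * hv2

end Star

end KaehlerForms

namespace KaehlerForms

variable {n k l m : ℕ}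

/-! ### Naturality under linear maps -/

theorem wedge_ext {h : k + l = m} {α α' : Alt n k} {β β' : Alt n l} {v w : Fin m → Cn n}
    (hα : ∀ σ : Equiv.Perm (Fin k ⊕ Fin l), α (fun i => v (sumIdx h (σ (Sum.inl i)))) =
      α' (fun i => w (sumIdx h (σ (Sum.inl i)))))
    (hβ : ∀ σ : Equiv.Perm (Fin k ⊕ Fin l), β (fun i => v (sumIdx h (σ (Sum.inr i)))) =
      β' (fun i => w (sumIdx h (σ (Sum.inr i))))) :
    castAt h (wedgeAt α β) v = castAt h (wedgeAt α' β') w := by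
  have hk : (k.factorial : ℂ) ≠ 0 := by exact_mod_cast k.factorial_ne_zero
  have hl : (l.factorial : ℂ) ≠ 0 := by exact_mod_cast l.factorial_ne_zero
  refine mul_left_cancel₀ (mul_ne_zero hk hl) ?_
  rw [wedge_apply, wedge_apply]
  exact Finset.sum_congr rfl fun σ _ => by rw [hα, hβ]

theorem wedge_comp (h : k + l = m) (α : Alt n k) (β : Alt n l) (A : Cn n →L[ℝ] Cn n) :
    (castAt h (wedgeAt α β)).compContinuousLinearMap A =
      castAt h (wedgeAt (α.compContinuousLinearMap A) (β.compContinuousLinearMap A)) := by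
  ext v
  exact wedge_ext (v := A ∘ v) (w := v) (fun _ => rfl) fun _ => rfl

theorem topForm_comp (η : Alt n (2 * n)) (A : Cn n →L[ℝ] Cn n) :
    η.compContinuousLinearMap A (frame n) = (A.det : ℂ) * η (frame n) := by
  refine (topForm_apply η.toAlternatingMap fun j => A (frame n j)).trans ?_
  refine congrArg (fun t : ℝ => (t : ℂ) * η (frame n)) ?_
  rw [ContinuousLinearMap.det, ← LinearMap.det_toMatrix (frameBasis n), ← Matrix.det_transpose]
  congr 1
  ext i j
  simp [LinearMap.toMatrix_apply]

/-- The matrix of a real linear map in the real frame. -/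
noncomputable def frameMatrix (A : Cn n →L[ℝ] Cn n) : Matrix (Fin (2 * n)) (Fin (2 * n)) ℝ :=
  LinearMap.toMatrix (frameBasis n) (frameBasis n) A.toLinearMap

theorem det_frameMatrix (A : Cn n →L[ℝ] Cn n) : (frameMatrix A).det = A.det :=
  LinearMap.det_toMatrix _ _

theorem map_frame (A : Cn n →L[ℝ] Cn n) (j : Fin (2 * n)) :
    A (frame n j) = frameOf (frameMatrix A) j := by
  conv_lhs => rw [← (frameBasis n).sum_repr (A (frame n j))]
  simp [frameOf, frameMatrix, LinearMap.toMatrix_apply]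

theorem map_frameOf_eq (A : Cn n →L[ℝ] Cn n) (P : Matrix (Fin (2 * n)) (Fin (2 * n)) ℝ)
    (j : Fin (2 * n)) : A (frameOf P j) = frameOf (frameMatrix A * P) j := by
  rw [frameOf, map_sum, frameOf]
  simp only [map_smul, map_frame, frameOf, Matrix.mul_apply, Finset.smul_sum, Finset.sum_smul,
    smul_smul]
  rw [Finset.sum_comm]
  exact Finset.sum_congr rfl fun i _ => Finset.sum_congr rfl fun s _ => by rw [mul_comm]

theorem gram_bilinearComp (g : Cn n →L[ℝ] Cn n →L[ℝ] ℝ) (A : Cn n →L[ℝ] Cn n) :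
    gram (g.bilinearComp A A) = (frameMatrix A).transpose * gram g * frameMatrix A := by
  ext i j
  simp only [gram, Matrix.of_apply, ContinuousLinearMap.bilinearComp_apply, map_frame, frameOf,
    Matrix.mul_apply, Matrix.transpose_apply, map_sum, map_smul, sum_apply, smul_apply,
    smul_eq_mul, Finset.sum_mul, Finset.mul_sum]
  refine Finset.sum_congr rfl fun s _ => Finset.sum_congr rfl fun t _ => ?_
  ring

/-- The root of `det (Aᵀ g A)` is `|det A| √(det g)`, whereas pulling back a top form produces `det
A`; they agree because `A` preserves orientation. -/
theorem volAlg_bilinearComp (g : Cn n →L[ℝ] Cn n →L[ℝ] ℝ) {A : Cn n →L[ℝ] Cn n} (hA : 0 < A.det)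
    (v : Fin (2 * n) → Cn n) :
    volAlg (g.bilinearComp A A) v = volAlg g (fun j => A (v j)) := by
  have h1 := topForm_comp (volAt g) A
  have h2 := topForm_apply ((volAt g).compContinuousLinearMap A).toAlternatingMap v
  refine (topForm_apply _ v).trans (Eq.trans ?_ h2.symm)
  congr 1
  refine Eq.trans ?_ h1.symm
  rw [volAlg_frame, gram_bilinearComp]
  change _ = _ * volAlg g (frame n)
  rw [volAlg_frame, Matrix.det_mul, Matrix.det_mul, Matrix.det_transpose, det_frameMatrix,
    mul_comm A.det, mul_assoc, mul_comm, Real.sqrt_mul (mul_self_nonneg _),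
    Real.sqrt_mul_self hA.le]
  push_cast
  ring

/-- The Hodge star commutes with orientation preserving isometries. -/
theorem starAt_comp (h : k + l = 2 * n) {g : Cn n →L[ℝ] Cn n →L[ℝ] ℝ}
    {P : Matrix (Fin (2 * n)) (Fin (2 * n)) ℝ} (hP : (gram g)⁻¹ = P * P.transpose)
    {A : Cn n →L[ℝ] Cn n} (hA : 0 < A.det) (β : Alt n k) :
    starAt h (g.bilinearComp A A) (β.compContinuousLinearMap A) =
      (starAt h g β).compContinuousLinearMap A := by
  have hM : IsUnit (frameMatrix A).det := by
    rw [det_frameMatrix]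
    exact hA.ne'.isUnit
  -- The frame `A⁻¹ P` is orthonormal for the pulled back metric and `A` carries it to the frame
  -- `P`, so the two sums agree term by term.
  have hP' : (gram (g.bilinearComp A A))⁻¹ =
      ((frameMatrix A)⁻¹ * P) * ((frameMatrix A)⁻¹ * P).transpose := by
    rw [gram_bilinearComp, Matrix.mul_inv_rev, Matrix.mul_inv_rev, hP, Matrix.transpose_mul,
      Matrix.transpose_nonsing_inv]
    simp only [Matrix.mul_assoc]
  ext v
  rw [ContinuousAlternatingMap.compContinuousLinearMap_apply, starAt_eq_sum h hP,
    starAt_eq_sum h hP']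
  have hu : ∀ j, A (frameOf ((frameMatrix A)⁻¹ * P) j) = frameOf P j := by
    intro j
    rw [map_frameOf_eq, Matrix.mul_nonsing_inv_cancel_left _ _ hM]
  congr 1
  refine Finset.sum_congr rfl fun M _ => ?_
  rw [volAlg_bilinearComp g hA]
  congr 1
  · simp [Function.comp_def, hu]
  · congr 1
    funext j
    rcases (sumIdx h).symm j with s | s <;> simp [hu]

/-! ### The operators `∂` and `∂̄` on `ℂⁿ` -/

/-- Pullback of forms under a linear map, as a continuous linear map. -/
noncomputable def pullbackCLM (A : Cn n →L[ℝ] Cn n) : Alt n k →L[ℝ] Alt n k :=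
  ContinuousAlternatingMap.compContinuousLinearMapCLM A

/-- Multiplication by `i` as a real linear map. -/
noncomputable def mulI (n : ℕ) : Cn n →L[ℝ] Cn n :=
  Complex.I • ContinuousLinearMap.id ℝ (Cn n)

@[simp] theorem mulI_apply (v : Cn n) : mulI n v = Complex.I • v := rfl

/-- The map `v ↦ (f v + c f (i v)) / 2`; for `c = -i` and `c = i` it is the complex linear and the
conjugate linear part of `f`. -/
noncomputable def partWith (c : ℂ) (f : Cn n →L[ℝ] Alt n k) : Cn n →L[ℝ] Alt n k :=
  (1 / 2 : ℂ) • (f + c • f.comp (mulI n))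

theorem linPart_eq (f : Cn n →L[ℝ] Alt n k) : linPart f = partWith (-Complex.I) f := by
  ext v w
  simp [linPart, partWith, mulI, sub_eq_add_neg]

@[simp] theorem partWith_apply (c : ℂ) (f : Cn n →L[ℝ] Alt n k) (v : Cn n) :
    partWith c f v = (1 / 2 : ℂ) • (f v + c • f (Complex.I • v)) := rfl

/-- `½ (d + c dᴶ)` on `ℂⁿ`, which is `∂` for `c = -i` and `∂̄` for `c = i`. -/
noncomputable def derivWith (c : ℂ) (η : Cn n → Alt n k) (y : Cn n) : Alt n (k + 1) :=
  .alternatizeUncurryFin (partWith c (fderiv ℝ η y))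

/-- Conjugating `d` by `J` replaces the direction of differentiation `v` by `i v` and leaves the
other slots untouched, since `J⁻¹ = -J` undoes `J` there. Naturality is thereby inherited from
`extDeriv`. -/
theorem derivWith_eq (c : ℂ) {η : Cn n → Alt n k} {y : Cn n} (hη : DifferentiableAt ℝ η y) :
    derivWith c η y = (1 / 2 : ℂ) • (extDeriv η y +
      c • (extDeriv (fun z => (η z).compContinuousLinearMap (-mulI n)) y).compContinuousLinearMap
        (mulI n)) := by
  have h1 : fderiv ℝ (fun z => (η z).compContinuousLinearMap (-mulI n)) y =
      (pullbackCLM (-mulI n)).comp (fderiv ℝ η y) :=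
    ((pullbackCLM (-mulI n)).hasFDerivAt.comp y hη.hasFDerivAt).fderiv
  ext v
  simp only [derivWith, extDeriv, h1, ContinuousAlternatingMap.smul_apply,
    ContinuousAlternatingMap.add_apply, ContinuousAlternatingMap.compContinuousLinearMap_apply,
    ContinuousAlternatingMap.alternatizeUncurryFin_apply, partWith_apply,
    smul_eq_mul, Finset.mul_sum, ← Finset.sum_add_distrib]
  refine Finset.sum_congr rfl fun i _ => ?_
  have h2 : ∀ w : Fin k → Cn n, (fun s => (-mulI n) ((mulI n) (w s))) = w := by
    intro w
    funext s
    simp [smul_smul]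
  have h3 : (pullbackCLM (-mulI n)).comp (fderiv ℝ η y)
      ((⇑(mulI n) ∘ v) i) (i.removeNth (⇑(mulI n) ∘ v)) =
      fderiv ℝ η y (Complex.I • v i) (i.removeNth v) :=
    congrArg (fderiv ℝ η y (Complex.I • v i)) (h2 (i.removeNth v))
  rw [h3]
  simp only [Int.reduceNeg, zsmul_eq_mul, Int.cast_pow, Int.cast_neg, Int.cast_one]
  ring

/-- `∂` and `∂̄` commute with holomorphic pullbacks. -/
theorem derivWith_pullback (c : ℂ) {η : Cn n → Alt n k} {φ : Cn n → Cn n} {x : Cn n}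
    (hη : DifferentiableAt ℝ η (φ x)) (hφ : ContDiffAt ℝ 2 φ x)
    (hJ : ∀ᶠ z in 𝓝 x, ∀ v, fderiv ℝ φ z (Complex.I • v) = Complex.I • fderiv ℝ φ z v) :
    derivWith c (fun z => (η (φ z)).compContinuousLinearMap (fderiv ℝ φ z)) x =
      (derivWith c η (φ x)).compContinuousLinearMap (fderiv ℝ φ x) := by
  have hdφ : DifferentiableAt ℝ (fderiv ℝ φ) x :=
    (hφ.fderiv_right (m := 1) (by norm_num)).differentiableAt (by norm_num)
  have hφ1 : DifferentiableAt ℝ φ x := hφ.differentiableAt (by norm_num)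
  have hp : DifferentiableAt ℝ (fun z => (η (φ z)).compContinuousLinearMap (fderiv ℝ φ z)) x :=
    DifferentiableAt.continuousAlternatingMapCompContinuousLinearMap (hη.comp x hφ1) hdφ
  have hη' : DifferentiableAt ℝ (fun z => (η z).compContinuousLinearMap (-mulI n)) (φ x) :=
    (pullbackCLM (-mulI n)).differentiableAt.comp _ hη
  -- Pullback by `J⁻¹` commutes with pullback by `φ`. This has to hold near `x` and not just at `x`,
  -- because the form is differentiated next.
  have h1 : (fun z => ((η (φ z)).compContinuousLinearMap (fderiv ℝ φ z)).compContinuousLinearMap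
      (-mulI n)) =ᶠ[𝓝 x] fun z => ((η (φ z)).compContinuousLinearMap
        (-mulI n)).compContinuousLinearMap (fderiv ℝ φ z) := by
    filter_upwards [hJ] with z hz
    ext v
    simp [Function.comp_def, hz]
  rw [derivWith_eq c hp, derivWith_eq c hη, extDeriv_pullback hη hφ (by simp),
    h1.extDeriv_eq, extDeriv_pullback hη' hφ (by simp)]
  ext v
  have := hJ.self_of_nhds
  simp [Function.comp_def, this]

/-! ### The Leibniz rule, antisymmetrized -/

/-- The `k + 1` terms of the alternatization contribute equally to the antisymmetrized sum, so one
may always differentiate along slot `0`; this absorbs the step from `k!` to `(k + 1)!`. -/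
theorem wedge_alternatize_left (h : k + 1 + l = m) (f : Cn n →L[ℝ] Alt n k) (β : Alt n l)
    (v : Fin m → Cn n) :
    (k.factorial * l.factorial : ℂ) *
        castAt h (wedgeAt (ContinuousAlternatingMap.alternatizeUncurryFin f) β) v =
      ∑ σ : Equiv.Perm (Fin (k + 1) ⊕ Fin l), ((Equiv.Perm.sign σ : ℤ) : ℂ) *
        (f (v (sumIdx h (σ (Sum.inl 0)))) (fun i => v (sumIdx h (σ (Sum.inl i.succ)))) *
          β (fun j => v (sumIdx h (σ (Sum.inr j))))) := by
  have hk : ((k + 1 : ℕ) : ℂ) ≠ 0 := by exact_mod_cast k.succ_ne_zero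
  refine mul_left_cancel₀ hk ?_
  have h1 := wedge_apply h (ContinuousAlternatingMap.alternatizeUncurryFin f) β v
  rw [Nat.factorial_succ] at h1
  rw [← mul_assoc, ← mul_assoc, ← Nat.cast_mul, h1]
  set R : Equiv.Perm (Fin (k + 1) ⊕ Fin l) → ℂ := fun σ => ((Equiv.Perm.sign σ : ℤ) : ℂ) *
        (f (v (sumIdx h (σ (Sum.inl 0)))) (fun i => v (sumIdx h (σ (Sum.inl i.succ)))) *
          β (fun j => v (sumIdx h (σ (Sum.inr j))))) with hR
  -- Precomposing with the inverse cycle on the slots `0, …, i` moves slot `i` to the front, and its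
  -- sign is the `(-1)^i` of the alternatization.
  have h2 : ∀ (σ : Equiv.Perm (Fin (k + 1) ⊕ Fin l)) (i : Fin (k + 1)),
      R (σ * Equiv.sumCongr i.cycleRange.symm (Equiv.refl _)) =
      ((Equiv.Perm.sign σ : ℤ) : ℂ) * (((-1) ^ (i : ℕ) * f (v (sumIdx h (σ (Sum.inl i))))
        (fun j => v (sumIdx h (σ (Sum.inl (i.succAbove j)))))) *
          β (fun j => v (sumIdx h (σ (Sum.inr j))))) := by
    intro σ i
    have hs : Equiv.Perm.sign (Equiv.sumCongr i.cycleRange.symm (Equiv.refl (Fin l))) =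
        (-1) ^ (i : ℕ) := by
      simp [Fin.sign_cycleRange]
    simp only [hR, Equiv.Perm.sign_mul, hs, Equiv.Perm.mul_apply, Equiv.sumCongr_apply,
      Sum.map_inl, Sum.map_inr, Fin.cycleRange_symm_zero, Fin.cycleRange_symm_succ,
      Equiv.refl_apply]
    push_cast
    ring
  have h3 : ∀ i : Fin (k + 1), ∑ σ, R σ =
      ∑ σ, R (σ * Equiv.sumCongr i.cycleRange.symm (Equiv.refl _)) := fun i =>
    (Equiv.sum_comp (Equiv.mulRight (Equiv.sumCongr i.cycleRange.symm (Equiv.refl (Fin l)) :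
      Equiv.Perm (Fin (k + 1) ⊕ Fin l))) R).symm
  have h4 : ((k + 1 : ℕ) : ℂ) * ∑ σ, R σ = ∑ i : Fin (k + 1), ∑ σ, R σ := by simp
  rw [h4, Finset.sum_congr rfl fun i _ => h3 i, Finset.sum_comm]
  refine Finset.sum_congr rfl fun σ _ => ?_
  simp only [h2, ContinuousAlternatingMap.alternatizeUncurryFin_apply, Finset.mul_sum,
    Finset.sum_mul]
  refine Finset.sum_congr rfl fun i _ => ?_
  simp only [Int.reduceNeg, zsmul_eq_mul, Int.cast_pow, Int.cast_neg, Int.cast_one]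
  rfl

theorem wedge_alternatize_right (h : k + (l + 1) = m) (α : Alt n k) (g : Cn n →L[ℝ] Alt n l)
    (v : Fin m → Cn n) :
    (k.factorial * l.factorial : ℂ) *
        castAt h (wedgeAt α (ContinuousAlternatingMap.alternatizeUncurryFin g)) v =
      ∑ σ : Equiv.Perm (Fin k ⊕ Fin (l + 1)), ((Equiv.Perm.sign σ : ℤ) : ℂ) *
        (α (fun i => v (sumIdx h (σ (Sum.inl i)))) *
          g (v (sumIdx h (σ (Sum.inr 0)))) (fun i => v (sumIdx h (σ (Sum.inr i.succ))))) := by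
  have hl : ((l + 1 : ℕ) : ℂ) ≠ 0 := by exact_mod_cast l.succ_ne_zero
  refine mul_left_cancel₀ hl ?_
  have h1 := wedge_apply h α (ContinuousAlternatingMap.alternatizeUncurryFin g) v
  rw [Nat.factorial_succ] at h1
  have h1' : ((l + 1 : ℕ) : ℂ) * ((k.factorial * l.factorial : ℂ) *
      castAt h (wedgeAt α (ContinuousAlternatingMap.alternatizeUncurryFin g)) v) =
      (k.factorial * ((l + 1) * l.factorial : ℕ) : ℂ) *
      castAt h (wedgeAt α (ContinuousAlternatingMap.alternatizeUncurryFin g)) v := by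
    push_cast
    ring
  rw [h1', h1]
  set R : Equiv.Perm (Fin k ⊕ Fin (l + 1)) → ℂ := fun σ => ((Equiv.Perm.sign σ : ℤ) : ℂ) *
        (α (fun i => v (sumIdx h (σ (Sum.inl i)))) *
          g (v (sumIdx h (σ (Sum.inr 0)))) (fun i => v (sumIdx h (σ (Sum.inr i.succ)))))
    with hR
  have h2 : ∀ (σ : Equiv.Perm (Fin k ⊕ Fin (l + 1))) (i : Fin (l + 1)),
      R (σ * Equiv.sumCongr (Equiv.refl _) i.cycleRange.symm) =
      ((Equiv.Perm.sign σ : ℤ) : ℂ) * (α (fun j => v (sumIdx h (σ (Sum.inl j)))) *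
        ((-1) ^ (i : ℕ) * g (v (sumIdx h (σ (Sum.inr i))))
        (fun j => v (sumIdx h (σ (Sum.inr (i.succAbove j))))))) := by
    intro σ i
    have hs : Equiv.Perm.sign (Equiv.sumCongr (Equiv.refl (Fin k)) i.cycleRange.symm) =
        (-1) ^ (i : ℕ) := by
      simp [Fin.sign_cycleRange]
    simp only [hR, Equiv.Perm.sign_mul, hs, Equiv.Perm.mul_apply, Equiv.sumCongr_apply,
      Sum.map_inl, Sum.map_inr, Fin.cycleRange_symm_zero, Fin.cycleRange_symm_succ,
      Equiv.refl_apply]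
    push_cast
    ring
  have h3 : ∀ i : Fin (l + 1), ∑ σ, R σ =
      ∑ σ, R (σ * Equiv.sumCongr (Equiv.refl _) i.cycleRange.symm) := fun i =>
    (Equiv.sum_comp (Equiv.mulRight (Equiv.sumCongr (Equiv.refl (Fin k)) i.cycleRange.symm :
      Equiv.Perm (Fin k ⊕ Fin (l + 1)))) R).symm
  have h4 : ((l + 1 : ℕ) : ℂ) * ∑ σ, R σ = ∑ i : Fin (l + 1), ∑ σ, R σ := by simp
  rw [h4, Finset.sum_congr rfl fun i _ => h3 i, Finset.sum_comm]
  refine Finset.sum_congr rfl fun σ _ => ?_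
  simp only [h2, ContinuousAlternatingMap.alternatizeUncurryFin_apply, Finset.mul_sum]
  refine Finset.sum_congr rfl fun i _ => ?_
  simp only [Int.reduceNeg, zsmul_eq_mul, Int.cast_pow, Int.cast_neg, Int.cast_one]
  rfl

/-- The splittings `(k + 1) + l` and `k + (l + 1)` have different index types; this brings both sums
to permutations of `Fin m`. -/
theorem sum_perm_transfer {ι κ : Type*} [Fintype ι] [DecidableEq ι] [Fintype κ] [DecidableEq κ]
    (e : ι ≃ κ) (R : (ι → κ) → ℂ) :
    ∑ σ : Equiv.Perm ι, ((Equiv.Perm.sign σ : ℤ) : ℂ) * R (fun i => e (σ i)) =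
      ∑ σ : Equiv.Perm κ, ((Equiv.Perm.sign σ : ℤ) : ℂ) * R (fun i => σ (e i)) := by
  rw [← e.permCongr.sum_comp]
  refine Finset.sum_congr rfl fun σ _ => ?_
  simp [Equiv.Perm.sign_permCongr, Equiv.permCongr_apply]

/-- Moving the derivative slot of `g` in front of the `k` slots of `α` costs exactly `(-1)^k`. Both
terms then have the same arguments, and each summand has the shape of the product rule. -/
theorem leibniz_antisymmetrized (h : k + 1 + l = m) (h' : k + (l + 1) = m)
    (f : Cn n →L[ℝ] Alt n k) (g : Cn n →L[ℝ] Alt n l) (α : Alt n k) (β : Alt n l)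
    (v : Fin m → Cn n) :
    (k.factorial * l.factorial : ℂ) *
        (castAt h (wedgeAt (ContinuousAlternatingMap.alternatizeUncurryFin f) β) v +
          (-1) ^ k *
            castAt h' (wedgeAt α (ContinuousAlternatingMap.alternatizeUncurryFin g)) v) =
      ∑ σ : Equiv.Perm (Fin m), ((Equiv.Perm.sign σ : ℤ) : ℂ) *
        (f (v (σ (sumIdx h (Sum.inl 0)))) (fun i => v (σ (sumIdx h (Sum.inl i.succ)))) *
          β (fun j => v (σ (sumIdx h (Sum.inr j)))) +
        α (fun i => v (σ (sumIdx h (Sum.inl i.succ)))) *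
          g (v (σ (sumIdx h (Sum.inl 0)))) (fun j => v (σ (sumIdx h (Sum.inr j))))) := by
  obtain ⟨N, rfl⟩ : ∃ N, m = N + 1 := ⟨k + l, by omega⟩
  have h1 := sum_perm_transfer (sumIdx h) (fun S =>
    f (v (S (Sum.inl 0))) (fun i => v (S (Sum.inl i.succ))) * β (fun j => v (S (Sum.inr j))))
  have h2 := sum_perm_transfer (sumIdx h') (fun S =>
    α (fun i => v (S (Sum.inl i))) * g (v (S (Sum.inr 0))) (fun i => v (S (Sum.inr i.succ))))
  -- The cycle sending position `k`, the derivative slot of the second splitting, to `0` and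
  -- shifting `0, …, k - 1` up by one.
  set c : Equiv.Perm (Fin (N + 1)) := Fin.cycleRange ⟨k, by omega⟩ with hc
  have c1 : ∀ i, c (sumIdx h' (Sum.inl i)) = sumIdx h (Sum.inl i.succ) := by
    intro i
    rw [hc, Fin.cycleRange_of_lt (by simp [sumIdx, Fin.lt_def])]
    ext
    rw [Fin.val_add_one_of_lt]
    · simp [sumIdx]
    · simp [sumIdx, Fin.lt_def]
      omega
  have c2 : c (sumIdx h' (Sum.inr 0)) = sumIdx h (Sum.inl 0) := by
    rw [hc, Fin.cycleRange_of_eq (by ext; simp [sumIdx])]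
    ext
    simp [sumIdx]
  have c3 : ∀ i, c (sumIdx h' (Sum.inr i.succ)) = sumIdx h (Sum.inr i) := by
    intro i
    rw [hc, Fin.cycleRange_of_gt (by simp [sumIdx, Fin.lt_def])]
    ext
    simp [sumIdx]
    omega
  have hs : ((Equiv.Perm.sign c : ℤ) : ℂ) = (-1) ^ k := by
    rw [hc, Fin.sign_cycleRange]
    simp
  beta_reduce at h1 h2
  rw [← Equiv.sum_comp (Equiv.mulRight c) (fun σ : Equiv.Perm (Fin (N + 1)) =>
    ((Equiv.Perm.sign σ : ℤ) : ℂ) *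
    (α (fun i => v (σ (sumIdx h' (Sum.inl i)))) * g (v (σ (sumIdx h' (Sum.inr 0))))
      (fun i => v (σ (sumIdx h' (Sum.inr i.succ))))))] at h2
  simp only [Equiv.coe_mulRight, Equiv.Perm.sign_mul, Equiv.Perm.mul_apply, c1, c2, c3,
    Units.val_mul, Int.cast_mul, hs] at h2
  rw [mul_add, wedge_alternatize_left, h1, mul_left_comm, wedge_alternatize_right, h2,
    Finset.mul_sum, ← Finset.sum_add_distrib]
  refine Finset.sum_congr rfl fun σ _ => ?_
  have : ((-1 : ℂ) ^ k) * (-1) ^ k = 1 := by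
    rw [← mul_pow]
    simp
  linear_combination ((Equiv.Perm.sign σ : ℤ) : ℂ) *
    (α (fun i => v (σ (sumIdx h (Sum.inl i.succ)))) *
      g (v (σ (sumIdx h (Sum.inl 0)))) (fun j => v (σ (sumIdx h (Sum.inr j))))) * this

end KaehlerForms

namespace KaehlerForms

variable {n k l m : ℕ}

/-! ### Smooth families of alternating maps -/

/-- The coefficients of a form with respect to the real frame. -/
noncomputable def coeffs (n k : ℕ) : Alt n k →ₗ[ℝ] ((Fin k → Fin (2 * n)) → ℂ) where
  toFun α I := α (fun s => frame n (I s))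
  map_add' _ _ := rfl
  map_smul' _ _ := rfl

theorem coeffs_injective : Function.Injective (coeffs n k) := by
  intro α β h
  apply ContinuousAlternatingMap.toAlternatingMap_injective
  refine Module.Basis.ext_alternating (frameBasis n) fun v _ => ?_
  simp only [frameBasis_apply]
  exact congrFun h v

instance finiteDimensional_alt : FiniteDimensional ℝ (Alt n k) :=
  FiniteDimensional.of_injective (coeffs n k) coeffs_injective

/-- Evaluation of forms at a tuple of vectors. -/
noncomputable def evalAt (v : Fin k → Cn n) : Alt n k →L[ℝ] ℂ :=
  LinearMap.toContinuousLinearMap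
    { toFun := fun α => α v
      map_add' := fun _ _ => rfl
      map_smul' := fun _ _ => rfl }

/-- A form depends linearly on its finitely many frame coefficients, and linear maps in finite
dimension are smooth. Smoothness questions thus become scalar. -/
theorem contDiffOn_alt_iff {E : Type*} [NormedAddCommGroup E] [NormedSpace ℝ E] {r : ℕ∞ω}
    {F : E → Alt n k} {s : Set E} :
    ContDiffOn ℝ r F s ↔ ∀ v, ContDiffOn ℝ r (fun y => F y v) s := by
  refine ⟨fun h v => (evalAt v).contDiff.comp_contDiffOn h, fun h => ?_⟩
  obtain ⟨T, hT⟩ := (coeffs n k).exists_leftInverse_of_injective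
    (LinearMap.ker_eq_bot.2 coeffs_injective)
  have h1 : F = fun y => LinearMap.toContinuousLinearMap T (coeffs n k (F y)) := by
    funext y
    exact (LinearMap.congr_fun hT (F y)).symm
  rw [h1]
  exact (LinearMap.toContinuousLinearMap T).contDiff.comp_contDiffOn
    (contDiffOn_pi.2 fun I => h _)

theorem contDiffOn_wedge {E : Type*} [NormedAddCommGroup E] [NormedSpace ℝ E] {r : ℕ∞ω}
    (h : k + l = m) {α : E → Alt n k} {β : E → Alt n l} {s : Set E} (hα : ContDiffOn ℝ r α s)
    (hβ : ContDiffOn ℝ r β s) : ContDiffOn ℝ r (fun y => castAt h (wedgeAt (α y) (β y))) s := by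
  rw [contDiffOn_alt_iff] at hα hβ ⊢
  intro v
  have hk : (k.factorial * l.factorial : ℂ) ≠ 0 := by
    exact_mod_cast mul_ne_zero k.factorial_ne_zero l.factorial_ne_zero
  have h1 : (fun y => castAt h (wedgeAt (α y) (β y)) v) = fun y =>
      (k.factorial * l.factorial : ℂ)⁻¹ * ∑ σ : Equiv.Perm (Fin k ⊕ Fin l),
        ((Equiv.Perm.sign σ : ℤ) : ℂ) * (α y (fun i => v (sumIdx h (σ (Sum.inl i)))) *
          β y (fun j => v (sumIdx h (σ (Sum.inr j))))) := by
    funext y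
    rw [← wedge_apply, inv_mul_cancel_left₀ hk]
  rw [h1]
  exact contDiffOn_const.mul (ContDiffOn.sum fun σ _ =>
    contDiffOn_const.mul ((hα _).mul (hβ _)))

theorem contDiffOn_derivWith (c : ℂ) {η : Cn n → Alt n k} {s : Set (Cn n)} (hs : IsOpen s)
    (hη : ContDiffOn ℝ ∞ η s) : ContDiffOn ℝ ∞ (derivWith c η) s := by
  have h1 : ContDiffOn ℝ ∞ (fderiv ℝ η) s := hη.fderiv_of_isOpen hs (by simp)
  rw [contDiffOn_alt_iff]
  intro v
  simp only [derivWith, ContinuousAlternatingMap.alternatizeUncurryFin_apply, partWith_apply]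
  have h2 : ∀ (w : Cn n) (u : Fin k → Cn n), ContDiffOn ℝ ∞ (fun y => fderiv ℝ η y w u) s :=
    fun w u => (evalAt u).contDiff.comp_contDiffOn (h1.clm_apply contDiffOn_const)
  refine ContDiffOn.sum fun i _ => ?_
  simp only [ContinuousAlternatingMap.smul_apply, ContinuousAlternatingMap.add_apply, smul_eq_mul,
    zsmul_eq_mul]
  exact contDiffOn_const.mul (contDiffOn_const.mul ((h2 _ _).add (contDiffOn_const.mul (h2 _ _))))

theorem derivWith_congr (c : ℂ) {η θ : Cn n → Alt n k} {y : Cn n} (h : η =ᶠ[𝓝 y] θ) :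
    derivWith c η y = derivWith c θ y := by
  rw [derivWith, derivWith, h.fderiv_eq]

/-! ### Charts of a complex manifold -/

variable {X : Type*} [TopologicalSpace X] [ChartedSpace (Cn n) X]

section Transition

variable [IsManifold 𝓘(ℂ, Cn n) ω X] {e e' : OpenPartialHomeomorph X (Cn n)}

theorem contDiffAt_transition (he : e ∈ atlas (Cn n) X) (he' : e' ∈ atlas (Cn n) X) {y : Cn n}
    (hy : y ∈ e.target) (hy' : e.symm y ∈ e'.source) :
    ContDiffAt ℂ ω (e' ∘ e.symm) y := by
  have h := (contDiffGroupoid ω 𝓘(ℂ, Cn n)).compatible he he'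
  rw [contDiffGroupoid, mem_groupoid_of_pregroupoid] at h
  have h1 : ContDiffOn ℂ ω (e' ∘ e.symm) (e.symm ≫ₕ e').source := by
    simpa [contDiffPregroupoid] using h.1
  exact h1.contDiffAt ((e.symm ≫ₕ e').open_source.mem_nhds (by simp [hy, hy']))

omit [ChartedSpace (Cn n) X] [IsManifold 𝓘(ℂ, Cn n) ω X] in
theorem eventually_mem_overlap {y : Cn n} (hy : y ∈ e.target) (hy' : e.symm y ∈ e'.source) :
    ∀ᶠ z in 𝓝 y, z ∈ e.target ∧ e.symm z ∈ e'.source :=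
  (e.open_target.eventually_mem hy).and
    ((e.continuousAt_symm hy).eventually (e'.open_source.eventually_mem hy'))

theorem fderiv_real_transition (he : e ∈ atlas (Cn n) X) (he' : e' ∈ atlas (Cn n) X) {y : Cn n}
    (hy : y ∈ e.target) (hy' : e.symm y ∈ e'.source) :
    fderiv ℝ (e' ∘ e.symm) y = (fderiv ℂ (e' ∘ e.symm) y).restrictScalars ℝ :=
  (((contDiffAt_transition he he' hy hy').differentiableAt (by simp)).fderiv_restrictScalars ℝ)

theorem contDiffAt_real_transition (he : e ∈ atlas (Cn n) X) (he' : e' ∈ atlas (Cn n) X)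
    {y : Cn n} (hy : y ∈ e.target) (hy' : e.symm y ∈ e'.source) (r : ℕ∞ω) :
    ContDiffAt ℝ r (e' ∘ e.symm) y :=
  ((contDiffAt_transition he he' hy hy').restrict_scalars ℝ).of_le le_top

theorem fderiv_transition_comp {e'' : OpenPartialHomeomorph X (Cn n)} (he : e ∈ atlas (Cn n) X)
    (he' : e' ∈ atlas (Cn n) X) (he'' : e'' ∈ atlas (Cn n) X) {y : Cn n}
    (hy : y ∈ e.target) (hy' : e.symm y ∈ e'.source) (hy'' : e.symm y ∈ e''.source) :
    fderiv ℝ (e'' ∘ e.symm) y =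
      (fderiv ℝ (e'' ∘ e'.symm) (e' (e.symm y))).comp (fderiv ℝ (e' ∘ e.symm) y) := by
  have h1 : (e'' ∘ e.symm) =ᶠ[𝓝 y] (e'' ∘ e'.symm) ∘ (e' ∘ e.symm) := by
    filter_upwards [eventually_mem_overlap hy hy'] with z hz
    simp [hz.2]
  have hd1 : DifferentiableAt ℝ (e'' ∘ e'.symm) ((e' ∘ e.symm) y) :=
    (contDiffAt_real_transition he' he'' (e'.map_source hy') (by simpa [hy'] using hy'') ω
      ).differentiableAt (by simp)
  have hd2 : DifferentiableAt ℝ (e' ∘ e.symm) y :=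
    (contDiffAt_real_transition he he' hy hy' ω).differentiableAt (by simp)
  rw [h1.fderiv_eq, fderiv_comp _ hd1 hd2]
  rfl

/-- Holomorphic changes of coordinates preserve the orientation. -/
theorem det_fderiv_transition_pos (he : e ∈ atlas (Cn n) X) (he' : e' ∈ atlas (Cn n) X)
    {y : Cn n} (hy : y ∈ e.target) (hy' : e.symm y ∈ e'.source) :
    0 < (fderiv ℝ (e' ∘ e.symm) y).det := by
  -- The chain rule for the round trip from `e` to `e'` and back, which is the identity near `y`.
  have h0 : (fderiv ℝ (e' ∘ e.symm) y).det ≠ 0 := by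
    have h1 := fderiv_transition_comp he he' he hy hy' (e.map_target hy)
    have h2 : (e ∘ e.symm) =ᶠ[𝓝 y] id := by
      filter_upwards [e.open_target.eventually_mem hy] with z hz
      simp [hz]
    rw [h2.fderiv_eq, fderiv_id] at h1
    have h3 := congrArg ContinuousLinearMap.det h1
    intro h4
    simp only [ContinuousLinearMap.det] at h3 h4
    rw [ContinuousLinearMap.toLinearMap_comp, LinearMap.det_comp, h4, mul_zero] at h3
    simp at h3
  refine lt_of_le_of_ne ?_ h0.symm
  rw [fderiv_real_transition he he' hy hy', ContinuousLinearMap.det]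
  -- The real determinant of a complex linear map is the norm of its complex determinant, that is,
  -- its squared modulus.
  have h5 := LinearMap.det_restrictScalars (R := ℝ) (S := ℂ)
    (f := (fderiv ℂ (e' ∘ e.symm) y).toLinearMap)
  refine le_of_le_of_eq ?_ h5.symm
  rw [Algebra.norm_complex_apply]
  exact Complex.normSq_nonneg _

/-- The tangent space at a point is identified with `ℂⁿ` through the preferred chart there, so the
derivative of a parametrization is that of a transition map. -/
theorem mfderiv_symm_eq (he : e ∈ atlas (Cn n) X) {y : Cn n} (hy : y ∈ e.target) :
    (mfderiv 𝓘(ℝ, Cn n) 𝓘(ℝ, Cn n) e.symm y : Cn n →L[ℝ] Cn n) =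
      fderiv ℝ (chartAt (Cn n) (e.symm y) ∘ e.symm) y := by
  have h1 : MDifferentiableAt 𝓘(ℝ, Cn n) 𝓘(ℝ, Cn n) e.symm y :=
    ((contMDiffOn_symm_of_mem_maximalAtlas (n := 1)
      (IsManifold.subset_maximalAtlas he)).contMDiffAt
        (e.open_target.mem_nhds hy)).mdifferentiableAt (by simp)
  simp only [mfderiv, h1, writtenInExtChartAt, extChartAt]
  simp [fderivWithin_univ]
  rfl

theorem inChart_eq (he : e ∈ atlas (Cn n) X) (a : Form n X k) {y : Cn n} (hy : y ∈ e.target) :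
    inChart e a y = (a (e.symm y)).compContinuousLinearMap
      (fderiv ℝ (chartAt (Cn n) (e.symm y) ∘ e.symm) y) := by
  rw [inChart, mfderiv_symm_eq he hy]

theorem inChart_transition (he : e ∈ atlas (Cn n) X) (he' : e' ∈ atlas (Cn n) X)
    (a : Form n X k) {y : Cn n} (hy : y ∈ e.target) (hy' : e.symm y ∈ e'.source) :
    inChart e a y = (inChart e' a (e' (e.symm y))).compContinuousLinearMap
      (fderiv ℝ (e' ∘ e.symm) y) := by
  rw [inChart_eq he a hy, inChart_eq he' a (e'.map_source hy'), e'.left_inv hy',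
    fderiv_transition_comp he he' (chart_mem_atlas _ _) hy hy' (mem_chart_source _ _)]
  rfl

/-! ### The operators `∂` and `∂̄` in charts -/

/-- The common form of `∂` and `∂̄` on a manifold. -/
noncomputable def derivForm (c : ℂ) (a : Form n X k) : Form n X (k + 1) := fun x =>
  derivWith c (inChart (chartAt (Cn n) x) a) (chartAt (Cn n) x x)

omit [IsManifold 𝓘(ℂ, Cn n) ω X] in
theorem delForm_eq (a : Form n X k) : delForm a = derivForm (-Complex.I) a := by
  funext x
  rw [delForm, linPart_eq]
  rfl

/-- `derivForm` uses a chart that changes from point to point. Naturality under holomorphic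
transitions replaces it by one fixed chart, as differentiation and integration over an open set
require. -/
theorem inChart_derivForm (c : ℂ) {a : Form n X k} (ha : IsSmoothForm a)
    (he : e ∈ atlas (Cn n) X) {y : Cn n} (hy : y ∈ e.target) :
    inChart e (derivForm c a) y = derivWith c (inChart e a) y := by
  set e' := chartAt (Cn n) (e.symm y) with he'd
  have he' : e' ∈ atlas (Cn n) X := chart_mem_atlas _ _
  have hy' : e.symm y ∈ e'.source := mem_chart_source _ _
  have h1 : inChart e a =ᶠ[𝓝 y] fun z =>
      (inChart e' a ((e' ∘ e.symm) z)).compContinuousLinearMap (fderiv ℝ (e' ∘ e.symm) z) := by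
    filter_upwards [eventually_mem_overlap hy hy'] with z hz
    exact inChart_transition he he' a hz.1 hz.2
  have hd : DifferentiableAt ℝ (inChart e' a) ((e' ∘ e.symm) y) :=
    ((ha e' he').contDiffAt (e'.open_target.mem_nhds (e'.map_source hy'))).differentiableAt
      (by simp)
  have hJ : ∀ᶠ z in 𝓝 y, ∀ v, fderiv ℝ (e' ∘ e.symm) z (Complex.I • v) =
      Complex.I • fderiv ℝ (e' ∘ e.symm) z v := by
    filter_upwards [eventually_mem_overlap hy hy'] with z hz v
    rw [fderiv_real_transition he he' hz.1 hz.2]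
    simp
  rw [derivWith_congr c h1, derivWith_pullback c hd (contDiffAt_real_transition he he' hy hy' 2) hJ,
    inChart_eq he _ hy]
  rfl

theorem IsSmoothForm.derivForm (c : ℂ) {a : Form n X k} (ha : IsSmoothForm a) :
    IsSmoothForm (derivForm c a) := fun e he =>
  (contDiffOn_derivWith c e.open_target (ha e he)).congr fun _ hy => inChart_derivForm c ha he hy

end Transition

/-! ### Algebraic operations on smooth forms -/

theorem inChart_wedge (e : OpenPartialHomeomorph X (Cn n)) (h : k + l = m) (a : Form n X k)
    (b : Form n X l) (y : Cn n) :
    inChart e (fun x => castAt h (wedgeAt (a x) (b x))) y =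
      castAt h (wedgeAt (inChart e a y) (inChart e b y)) :=
  wedge_comp h _ _ _

theorem IsSmoothForm.wedge (h : k + l = m) {a : Form n X k} {b : Form n X l}
    (ha : IsSmoothForm a) (hb : IsSmoothForm b) :
    IsSmoothForm (fun x => castAt h (wedgeAt (a x) (b x))) := fun e he =>
  (contDiffOn_wedge h (ha e he) (hb e he)).congr fun y _ => inChart_wedge e h a b y

theorem inChart_add (e : OpenPartialHomeomorph X (Cn n)) (a b : Form n X k) (y : Cn n) :
    inChart e (a + b) y = inChart e a y + inChart e b y := rfl

theorem inChart_smul (e : OpenPartialHomeomorph X (Cn n)) (f : X → ℂ) (a : Form n X k) (y : Cn n) :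
    inChart e (fun x => f x • a x) y = f (e.symm y) • inChart e a y := rfl

theorem inChart_zero (e : OpenPartialHomeomorph X (Cn n)) (y : Cn n) :
    inChart e (0 : Form n X k) y = 0 := rfl

theorem inChart_sum {ι : Type*} (s : Finset ι) (e : OpenPartialHomeomorph X (Cn n))
    (a : ι → Form n X k) (y : Cn n) :
    inChart e (∑ i ∈ s, a i) y = ∑ i ∈ s, inChart e (a i) y := by
  classical
  induction s using Finset.induction_on with
  | empty => rfl
  | insert i s hi ih => rw [Finset.sum_insert hi, Finset.sum_insert hi, inChart_add, ih]

theorem IsSmoothForm.add {a b : Form n X k} (ha : IsSmoothForm a) (hb : IsSmoothForm b) :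
    IsSmoothForm (a + b) := fun e he => (ha e he).add (hb e he)

theorem IsSmoothForm.const_smul (c : ℂ) {a : Form n X k} (ha : IsSmoothForm a) :
    IsSmoothForm (c • a) := fun e he => (ha e he).const_smul c

theorem isSmoothForm_zero : IsSmoothForm (0 : Form n X k) := fun e _ =>
  (contDiffOn_const (c := (0 : Alt n k))).congr fun y _ => inChart_zero e y

theorem IsSmoothForm.sum {ι : Type*} {s : Finset ι} {a : ι → Form n X k}
    (ha : ∀ i ∈ s, IsSmoothForm (a i)) : IsSmoothForm (∑ i ∈ s, a i) := fun e he =>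
  (ContDiffOn.sum fun i hi => ha i hi e he).congr fun y _ => inChart_sum s e a y

theorem IsSmoothForm.smul [IsManifold 𝓘(ℂ, Cn n) ω X] {f : X → ℝ}
    (hf : ContMDiff 𝓘(ℝ, Cn n) 𝓘(ℝ, ℝ) ∞ f) {a : Form n X k} (ha : IsSmoothForm a) :
    IsSmoothForm (fun x => (f x : ℂ) • a x) := fun e he => by
  have h1 : ContDiffOn ℝ ∞ (fun y => f (e.symm y)) e.target :=
    contMDiffOn_iff_contDiffOn.1 (hf.comp_contMDiffOn (contMDiffOn_symm_of_mem_maximalAtlas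
      (IsManifold.subset_maximalAtlas he)))
  exact (h1.smul (ha e he)).congr fun y _ => by
    rw [inChart_smul]
    exact Complex.coe_smul (f (e.symm y)) (inChart e a y)

end KaehlerForms

namespace KaehlerForms

variable {n k l m : ℕ}

/-! ### Linearity -/

theorem factorial_mul_ne_zero (k l : ℕ) : (k.factorial * l.factorial : ℂ) ≠ 0 := by
  exact_mod_cast mul_ne_zero k.factorial_ne_zero l.factorial_ne_zero

/-- The wedge product as a bilinear map. -/
noncomputable def wedgeHom (h : k + l = m) : Alt n k →ₗ[ℂ] Alt n l →ₗ[ℂ] Alt n m :=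
  LinearMap.mk₂ ℂ (fun α β => castAt h (wedgeAt α β))
    (by
      intro α α' β
      ext v
      refine mul_left_cancel₀ (b := castAt h (wedgeAt (α + α') β) v) (factorial_mul_ne_zero k l) ?_
      rw [ContinuousAlternatingMap.add_apply, mul_add, wedge_apply, wedge_apply, wedge_apply,
        ← Finset.sum_add_distrib]
      refine Finset.sum_congr rfl fun σ _ => ?_
      rw [ContinuousAlternatingMap.add_apply]
      ring)
    (by
      intro c α β
      ext v
      refine mul_left_cancel₀ (b := castAt h (wedgeAt (c • α) β) v) (factorial_mul_ne_zero k l) ?_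
      rw [ContinuousAlternatingMap.smul_apply, smul_eq_mul, mul_left_comm, wedge_apply,
        wedge_apply, Finset.mul_sum]
      refine Finset.sum_congr rfl fun σ _ => ?_
      rw [ContinuousAlternatingMap.smul_apply, smul_eq_mul]
      ring)
    (by
      intro α β β'
      ext v
      refine mul_left_cancel₀ (b := castAt h (wedgeAt α (β + β')) v) (factorial_mul_ne_zero k l) ?_
      rw [ContinuousAlternatingMap.add_apply, mul_add, wedge_apply, wedge_apply, wedge_apply,
        ← Finset.sum_add_distrib]
      refine Finset.sum_congr rfl fun σ _ => ?_
      rw [ContinuousAlternatingMap.add_apply]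
      ring)
    (by
      intro c α β
      ext v
      refine mul_left_cancel₀ (b := castAt h (wedgeAt α (c • β)) v) (factorial_mul_ne_zero k l) ?_
      rw [ContinuousAlternatingMap.smul_apply, smul_eq_mul, mul_left_comm, wedge_apply,
        wedge_apply, Finset.mul_sum]
      refine Finset.sum_congr rfl fun σ _ => ?_
      rw [ContinuousAlternatingMap.smul_apply, smul_eq_mul]
      ring)

theorem wedgeHom_apply (h : k + l = m) (α : Alt n k) (β : Alt n l) :
    wedgeHom h α β = castAt h (wedgeAt α β) := rfl

theorem derivWith_add (c : ℂ) {η θ : Cn n → Alt n k} {y : Cn n} (hη : DifferentiableAt ℝ η y)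
    (hθ : DifferentiableAt ℝ θ y) :
    derivWith c (fun z => η z + θ z) y = derivWith c η y + derivWith c θ y := by
  rw [derivWith, fderiv_fun_add hη hθ, derivWith, derivWith,
    ← ContinuousAlternatingMap.alternatizeUncurryFin_add]
  congr 1
  ext v w
  simp only [partWith_apply, add_apply, ContinuousAlternatingMap.add_apply,
    ContinuousAlternatingMap.smul_apply, smul_eq_mul]
  ring

theorem derivWith_zero (c : ℂ) (y : Cn n) : derivWith c (fun _ => (0 : Alt n k)) y = 0 := by
  ext v
  simp [derivWith, ContinuousAlternatingMap.alternatizeUncurryFin_apply]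

variable {X : Type*} [TopologicalSpace X] [ChartedSpace (Cn n) X]

theorem IsSmoothForm.differentiableAt {a : Form n X k} (ha : IsSmoothForm a)
    {e : OpenPartialHomeomorph X (Cn n)} (he : e ∈ atlas (Cn n) X) {y : Cn n} (hy : y ∈ e.target) :
    DifferentiableAt ℝ (inChart e a) y :=
  ((ha e he).contDiffAt (e.open_target.mem_nhds hy)).differentiableAt (by simp)

theorem derivForm_add (c : ℂ) {a b : Form n X k} (ha : IsSmoothForm a) (hb : IsSmoothForm b) :
    derivForm c (a + b) = derivForm c a + derivForm c b := by
  funext x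
  have h : inChart (chartAt (Cn n) x) (a + b) =
      fun z => inChart (chartAt (Cn n) x) a z + inChart (chartAt (Cn n) x) b z :=
    funext (inChart_add (chartAt (Cn n) x) a b)
  rw [derivForm, h, derivWith_add c
    (ha.differentiableAt (chart_mem_atlas _ _) (mem_chart_target _ _))
    (hb.differentiableAt (chart_mem_atlas _ _) (mem_chart_target _ _))]
  rfl

theorem derivForm_zero (c : ℂ) : derivForm c (0 : Form n X k) = 0 := by
  funext x
  have h : inChart (chartAt (Cn n) x) (0 : Form n X k) = fun _ => 0 :=
    funext (inChart_zero (chartAt (Cn n) x))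
  rw [derivForm, h, derivWith_zero]
  rfl

theorem derivForm_sum (c : ℂ) {ι : Type*} (s : Finset ι) {a : ι → Form n X k}
    (ha : ∀ i ∈ s, IsSmoothForm (a i)) :
    derivForm c (∑ i ∈ s, a i) = ∑ i ∈ s, derivForm c (a i) := by
  classical
  induction s using Finset.induction_on with
  | empty => exact derivForm_zero c
  | insert i s hi ih =>
    have hs : ∀ j ∈ s, IsSmoothForm (a j) := fun j hj => ha j (Finset.mem_insert_of_mem hj)
    rw [Finset.sum_insert hi, Finset.sum_insert hi,
      derivForm_add c (ha i (Finset.mem_insert_self i s)) (IsSmoothForm.sum hs), ih hs]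

theorem derivForm_eq_zero (c : ℂ) {a : Form n X k} {x : X} (ha : ∀ᶠ z in 𝓝 x, a z = 0) :
    derivForm c a x = 0 := by
  have h1 : inChart (chartAt (Cn n) x) a =ᶠ[𝓝 (chartAt (Cn n) x x)] fun _ => 0 := by
    have h2 : Filter.Tendsto (chartAt (Cn n) x).symm (𝓝 (chartAt (Cn n) x x)) (𝓝 x) := by
      have := (chartAt (Cn n) x).continuousAt_symm (mem_chart_target (Cn n) x)
      rwa [ContinuousAt, (chartAt (Cn n) x).left_inv (mem_chart_source _ _)] at this
    filter_upwards [h2.eventually ha] with z hz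
    rw [inChart, hz]
    rfl
  rw [derivForm, derivWith_congr c h1, derivWith_zero]

theorem inChart_eq_zero {e : OpenPartialHomeomorph X (Cn n)} {a : Form n X k} {y : Cn n}
    (h : a (e.symm y) = 0) : inChart e a y = 0 := by
  rw [inChart, h]
  rfl

theorem inChart_frame_eq_zero {e : OpenPartialHomeomorph X (Cn n)} {a : Form n X (2 * n)}
    {y : Cn n} (h : a (e.symm y) = 0) : inChart e a y (frame n) = 0 := by
  rw [inChart_eq_zero h]
  rfl

/-! ### Functions with compact support in a chart -/

section ChartSupport

variable [CompactSpace X] {e : OpenPartialHomeomorph X (Cn n)} {K : Set X} {F : Cn n → ℂ}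

omit [ChartedSpace (Cn n) X] in
theorem isCompact_image_chart (hK : IsClosed K) (hKe : K ⊆ e.source) : IsCompact (e '' K) :=
  hK.isCompact.image_of_continuousOn (e.continuousOn.mono hKe)

omit [ChartedSpace (Cn n) X] [CompactSpace X] in
theorem image_chart_subset (hKe : K ⊆ e.source) : e '' K ⊆ e.target := by
  rintro _ ⟨x, hx, rfl⟩
  exact e.map_source (hKe hx)

omit [ChartedSpace (Cn n) X] [CompactSpace X] in
theorem eq_zero_of_notMem_image (hF : ∀ y ∈ e.target, e.symm y ∉ K → F y = 0) {y : Cn n}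
    (hy : y ∈ e.target) (hyK : y ∉ e '' K) : F y = 0 :=
  hF y hy fun h => hyK ⟨e.symm y, h, e.right_inv hy⟩

omit [ChartedSpace (Cn n) X] in
theorem integrableOn_chart (hK : IsClosed K) (hKe : K ⊆ e.source)
    (hc : ContinuousOn F e.target) (hF : ∀ y ∈ e.target, e.symm y ∉ K → F y = 0) :
    IntegrableOn F e.target := by
  have hKc := isCompact_image_chart hK hKe
  have h1 : IntegrableOn F (e '' K) :=
    (hc.mono (image_chart_subset hKe)).integrableOn_compact hKc
  exact h1.of_forall_sdiff_eq_zero e.open_target.measurableSet fun y hy =>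
    eq_zero_of_notMem_image hF hy.1 hy.2

omit [ChartedSpace (Cn n) X] [CompactSpace X] in
theorem fderiv_eq_zero_of_notMem (hK : IsClosed K)
    (hF : ∀ y ∈ e.target, e.symm y ∉ K → F y = 0) (v : Cn n) :
    ∀ y ∈ e.target, e.symm y ∉ K → fderiv ℝ F y v = 0 := by
  intro y hy hyK
  have h1 : F =ᶠ[𝓝 y] fun _ => 0 := by
    filter_upwards [e.open_target.eventually_mem hy,
      (e.continuousAt_symm hy).eventually (hK.isOpen_compl.eventually_mem hyK)] with z hz hzK
    exact hF z hz hzK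
  rw [h1.fderiv_eq]
  simp

omit [ChartedSpace (Cn n) X] in
/-- The integral of a derivative vanishes. -/
theorem setIntegral_fderiv_eq_zero (hK : IsClosed K) (hKe : K ⊆ e.source)
    (hc : ContDiffOn ℝ ∞ F e.target) (hF : ∀ y ∈ e.target, e.symm y ∉ K → F y = 0) (v : Cn n) :
    ∫ y in e.target, fderiv ℝ F y v = 0 := by
  have hKc := isCompact_image_chart hK hKe
  -- Extension by zero is smooth on all of `ℂⁿ`, because the compact set `e '' K` lies inside the
  -- open target.
  set G := e.target.indicator F with hG
  have hG0 : ∀ y, y ∉ e '' K → G y = 0 := by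
    intro y hy
    by_cases h : y ∈ e.target
    · rw [hG, indicator_of_mem h]
      exact eq_zero_of_notMem_image hF h hy
    · rw [hG, indicator_of_notMem h]
  have hGF : ∀ y ∈ e.target, G =ᶠ[𝓝 y] F := by
    intro y hy
    filter_upwards [e.open_target.eventually_mem hy] with z hz
    rw [hG, indicator_of_mem hz]
  have hGs : ContDiff ℝ ∞ G := by
    rw [contDiff_iff_contDiffAt]
    intro y
    by_cases h : y ∈ e.target
    · exact (hc.contDiffAt (e.open_target.mem_nhds h)).congr_of_eventuallyEq (hGF y h)
    · refine contDiffAt_const (c := (0 : ℂ)) |>.congr_of_eventuallyEq ?_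
      filter_upwards [hKc.isClosed.isOpen_compl.eventually_mem
        (fun hy => h (image_chart_subset hKe hy))] with z hz
      exact hG0 z hz
  have hGc : HasCompactSupport G := HasCompactSupport.intro hKc hG0
  have h1 : ∫ y in e.target, fderiv ℝ F y v = ∫ y in e.target, fderiv ℝ G y v :=
    setIntegral_congr_fun e.open_target.measurableSet fun y hy => by
      simp only [(hGF y hy).fderiv_eq]
  have h2 : ∫ y in e.target, fderiv ℝ G y v = ∫ y, fderiv ℝ G y v := by
    refine setIntegral_eq_integral_of_forall_compl_eq_zero fun y hy => ?_
    have : G =ᶠ[𝓝 y] fun _ => 0 := by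
      filter_upwards [hKc.isClosed.isOpen_compl.eventually_mem
        (fun h => hy (image_chart_subset hKe h))] with z hz
      exact hG0 z hz
    rw [this.fderiv_eq]
    simp
  have hGd : Continuous fun y => fderiv ℝ G y v :=
    (hGs.continuous_fderiv (by simp)).clm_apply continuous_const
  -- Integration by parts against the constant function `1`, whose derivative vanishes.
  have h3 := integral_mul_fderiv_eq_neg_fderiv_mul_of_integrable (μ := (volume : Measure (Cn n)))
    (f := fun _ : Cn n => (1 : ℂ)) (g := G) (v := v) (by simp)
    (by
      simp only [one_mul]
      exact hGd.integrable_of_hasCompactSupport (hGc.fderiv_apply ℝ v))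
    (by
      simp only [one_mul]
      exact hGs.continuous.integrable_of_hasCompactSupport hGc)
    (fun _ _ => differentiableAt_const _)
    (fun y _ => (hGs.differentiable (by simp)) y)
  rw [h1, h2]
  simpa using h3

end ChartSupport

/-! ### Integration of forms of top degree -/

section Integral

variable [IsManifold 𝓘(ℂ, Cn n) ω X]

/-- The integral of a form of top degree over a chart. -/
noncomputable def chartIntegral (e : OpenPartialHomeomorph X (Cn n)) (a : Form n X (2 * n)) : ℂ :=
  ∫ y in e.target, inChart e a y (frame n)

/-- Change of variables along the transition map: Lebesgue measure contributes `|det|` and the top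
form `det`, which coincide by positivity. -/
theorem setIntegral_inChart_eq {e e' : OpenPartialHomeomorph X (Cn n)} (he : e ∈ atlas (Cn n) X)
    (he' : e' ∈ atlas (Cn n) X) (a : Form n X (2 * n)) :
    ∫ y in e'.target ∩ e'.symm ⁻¹' e.source, inChart e' a y (frame n) =
      ∫ y in e.target ∩ e.symm ⁻¹' e'.source, inChart e a y (frame n) := by
  have himg : (e' ∘ e.symm) '' (e.target ∩ e.symm ⁻¹' e'.source) =
      e'.target ∩ e'.symm ⁻¹' e.source := by
    ext z
    constructor
    · rintro ⟨y, ⟨hy, hy'⟩, rfl⟩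
      exact ⟨e'.map_source hy', by simpa [e'.left_inv hy'] using e.map_target hy⟩
    · rintro ⟨hz, hz'⟩
      exact ⟨e (e'.symm z), ⟨e.map_source hz', by simpa [e.left_inv hz'] using e'.map_target hz⟩,
        by simp [e.left_inv hz', e'.right_inv hz]⟩
  have hopen : IsOpen (e.target ∩ e.symm ⁻¹' e'.source) :=
    e.isOpen_inter_preimage_symm e'.open_source
  rw [← himg, integral_image_eq_integral_abs_det_fderiv_smul volume hopen.measurableSet
    (f' := fun y => fderiv ℝ (e' ∘ e.symm) y)]
  · refine setIntegral_congr_fun hopen.measurableSet fun y hy => ?_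
    have h1 := topForm_comp (inChart e' a (e' (e.symm y))) (fderiv ℝ (e' ∘ e.symm) y)
    rw [← inChart_transition he he' a hy.1 hy.2] at h1
    rw [h1, abs_of_pos (det_fderiv_transition_pos he he' hy.1 hy.2), Complex.real_smul]
    rfl
  · intro y hy
    exact ((contDiffAt_real_transition he he' hy.1 hy.2 ω).differentiableAt
      (by simp)).hasFDerivAt.hasFDerivWithinAt
  · intro y hy z hz hyz
    have h1 := e'.injOn hy.2 hz.2 hyz
    exact e.symm.injOn hy.1 hz.1 h1

theorem chartIntegral_eq_of_support {e e' : OpenPartialHomeomorph X (Cn n)}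
    (he : e ∈ atlas (Cn n) X) (he' : e' ∈ atlas (Cn n) X) {a : Form n X (2 * n)}
    (ha : ∀ x ∉ e.source, a x = 0) (ha' : ∀ x ∉ e'.source, a x = 0) :
    chartIntegral e' a = chartIntegral e a := by
  have h1 : chartIntegral e' a =
      ∫ y in e'.target ∩ e'.symm ⁻¹' e.source, inChart e' a y (frame n) := by
    rw [chartIntegral]
    refine setIntegral_eq_of_subset_of_forall_sdiff_eq_zero
      (μ := volume) (s := e'.target ∩ e'.symm ⁻¹' e.source)
      (f := fun y => inChart e' a y (frame n)) e'.open_target.measurableSet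
      inter_subset_left fun y hy => ?_
    exact inChart_frame_eq_zero (ha _ fun h => hy.2 ⟨hy.1, h⟩)
  have h2 : chartIntegral e a =
      ∫ y in e.target ∩ e.symm ⁻¹' e'.source, inChart e a y (frame n) := by
    rw [chartIntegral]
    refine setIntegral_eq_of_subset_of_forall_sdiff_eq_zero
      (μ := volume) (s := e.target ∩ e.symm ⁻¹' e'.source)
      (f := fun y => inChart e a y (frame n)) e.open_target.measurableSet
      inter_subset_left fun y hy => ?_
    exact inChart_frame_eq_zero (ha' _ fun h => hy.2 ⟨hy.1, h⟩)
  rw [h1, h2, setIntegral_inChart_eq he he']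

variable [T2Space X] [CompactSpace X]

theorem tsupport_chartPartition (i : X) :
    tsupport (chartPartition n X i) ⊆ (chartAt (Cn n) i).source :=
  (SmoothPartitionOfUnity.exists_isSubordinate_chartAt_source 𝓘(ℝ, Cn n) X).choose_spec i

variable (n X) in
/-- The charts which contribute to the partition of unity. -/
noncomputable def partIdx : Finset X :=
  ((chartPartition n X).locallyFinite.finite_nonempty_of_compact).toFinset

theorem chartPartition_eq_zero {i : X} (hi : i ∉ partIdx n X) (x : X) :
    chartPartition n X i x = 0 := by
  by_contra h
  exact hi ((Set.Finite.mem_toFinset _).2 ⟨x, h⟩)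

theorem sum_chartPartition (x : X) : ∑ i ∈ partIdx n X, chartPartition n X i x = 1 := by
  rw [← (chartPartition n X).sum_eq_one (mem_univ x)]
  refine (finsum_eq_sum_of_support_subset _ fun i hi => ?_).symm
  by_contra h
  exact hi (chartPartition_eq_zero h x)

/-- Multiplication of a form by a function of the partition of unity. -/
noncomputable def cutoff (i : X) (a : Form n X k) : Form n X k :=
  fun x => ((chartPartition n X i x : ℝ) : ℂ) • a x

theorem IsSmoothForm.cutoff (i : X) {a : Form n X k} (ha : IsSmoothForm a) :
    IsSmoothForm (cutoff i a) :=
  ha.smul (chartPartition n X i).contMDiff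

theorem cutoff_eq_zero {i x : X} (hx : x ∉ tsupport (chartPartition n X i)) (a : Form n X k) :
    cutoff i a x = 0 := by
  rw [cutoff, image_eq_zero_of_notMem_tsupport hx, Complex.ofReal_zero]
  exact zero_smul ℂ (a x)

theorem sum_cutoff (a : Form n X k) : ∑ i ∈ partIdx n X, cutoff i a = a := by
  funext x
  rw [Finset.sum_apply]
  simp only [cutoff]
  rw [← Finset.sum_smul, ← Complex.ofReal_sum, sum_chartPartition]
  simp

theorem integralTop_eq_sum (a : Form n X (2 * n)) :
    integralTop a = ∑ i ∈ partIdx n X, chartIntegral (chartAt (Cn n) i) (cutoff i a) := by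
  refine finsum_eq_sum_of_support_subset _ fun i hi => ?_
  by_contra h
  refine hi ?_
  simp [chartPartition_eq_zero h]

omit [IsManifold 𝓘(ℂ, Cn n) ω X] [T2Space X] in
theorem integrableOn_inChart {e : OpenPartialHomeomorph X (Cn n)} (he : e ∈ atlas (Cn n) X)
    {K : Set X} (hK : IsClosed K) (hKe : K ⊆ e.source) {a : Form n X (2 * n)}
    (ha : IsSmoothForm a) (haK : ∀ x ∉ K, a x = 0) :
    IntegrableOn (fun y => inChart e a y (frame n)) e.target :=
  integrableOn_chart hK hKe (contDiffOn_alt_iff.1 (ha e he) (frame n)).continuousOn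
    fun _ _ h => inChart_frame_eq_zero (haK _ h)

theorem integrableOn_cutoff (i : X) {a : Form n X (2 * n)} (ha : IsSmoothForm a) :
    IntegrableOn (fun y => inChart (chartAt (Cn n) i) (cutoff i a) y (frame n))
      (chartAt (Cn n) i).target :=
  integrableOn_inChart (chart_mem_atlas _ _) (isClosed_tsupport _) (tsupport_chartPartition i)
    (ha.cutoff i) fun _ hx => cutoff_eq_zero hx a

theorem integralTop_add {a b : Form n X (2 * n)} (ha : IsSmoothForm a) (hb : IsSmoothForm b) :
    integralTop (a + b) = integralTop a + integralTop b := by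
  rw [integralTop_eq_sum, integralTop_eq_sum, integralTop_eq_sum, ← Finset.sum_add_distrib]
  refine Finset.sum_congr rfl fun i _ => ?_
  rw [chartIntegral, chartIntegral, chartIntegral,
    ← integral_add (integrableOn_cutoff i ha) (integrableOn_cutoff i hb)]
  congr 1
  funext y
  have : cutoff i (a + b) = cutoff i a + cutoff i b := by
    funext x
    exact smul_add _ _ _
  rw [this]
  rfl

theorem integralTop_smul (c : ℂ) (a : Form n X (2 * n)) :
    integralTop (c • a) = c * integralTop a := by
  rw [integralTop_eq_sum, integralTop_eq_sum, Finset.mul_sum]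
  refine Finset.sum_congr rfl fun i _ => ?_
  rw [chartIntegral, chartIntegral, ← integral_const_mul]
  congr 1
  funext y
  have : cutoff i (c • a) = c • cutoff i a := by
    funext x
    exact smul_comm ((chartPartition n X i x : ℝ) : ℂ) c (a x)
  rw [this]
  rfl

theorem integralTop_zero : integralTop (0 : Form n X (2 * n)) = 0 := by
  have h := integralTop_smul 0 (0 : Form n X (2 * n))
  have h0 : (0 : ℂ) • (0 : Form n X (2 * n)) = 0 := funext fun _ => zero_smul ℂ (0 : Alt n (2 * n))
  rwa [h0, zero_mul] at h

theorem integralTop_sum {ι : Type*} (s : Finset ι) {a : ι → Form n X (2 * n)}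
    (ha : ∀ i ∈ s, IsSmoothForm (a i)) :
    integralTop (∑ i ∈ s, a i) = ∑ i ∈ s, integralTop (a i) := by
  classical
  induction s using Finset.induction_on with
  | empty => exact integralTop_zero
  | insert i s hi ih =>
    have hs : ∀ j ∈ s, IsSmoothForm (a j) := fun j hj => ha j (Finset.mem_insert_of_mem hj)
    rw [Finset.sum_insert hi, Finset.sum_insert hi,
      integralTop_add (ha i (Finset.mem_insert_self i s)) (IsSmoothForm.sum hs), ih hs]

/-- The integral of a form supported in one chart can be computed in this chart. -/
theorem integralTop_eq_chartIntegral {e : OpenPartialHomeomorph X (Cn n)}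
    (he : e ∈ atlas (Cn n) X) {K : Set X} (hK : IsClosed K) (hKe : K ⊆ e.source)
    {a : Form n X (2 * n)} (ha : IsSmoothForm a) (haK : ∀ x ∉ K, a x = 0) :
    integralTop a = chartIntegral e a := by
  have hz : ∀ (i : X) x, x ∉ K → cutoff i a x = 0 := by
    intro i x hx
    rw [cutoff, haK x hx]
    exact smul_zero (A := Alt n (2 * n)) ((chartPartition n X i x : ℝ) : ℂ)
  -- Each piece is supported in both its own chart and `e`, so all pieces can be integrated in `e`
  -- and summed there.
  have h1 : ∀ i, chartIntegral (chartAt (Cn n) i) (cutoff i a) = chartIntegral e (cutoff i a) :=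
    fun i => chartIntegral_eq_of_support he (chart_mem_atlas _ _)
      (fun x hx => hz i x fun h => hx (hKe h))
      fun x hx => cutoff_eq_zero (fun h => hx (tsupport_chartPartition i h)) a
  rw [integralTop_eq_sum, Finset.sum_congr rfl fun i _ => h1 i]
  simp only [chartIntegral]
  rw [← integral_finsetSum _ fun i _ => integrableOn_inChart he hK hKe (ha.cutoff i) (hz i)]
  congr 1
  funext y
  conv_rhs => rw [← sum_cutoff a]
  rw [inChart_sum, ContinuousAlternatingMap.sum_apply]

/-! ### Integration by parts -/

/-- The form `Da ∧ b + (-1)^k a ∧ Db` for `D = ∂` or `D = ∂̄`. -/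
noncomputable def leibnizForm (c : ℂ) (h : k + 1 + l = m) (h' : k + (l + 1) = m)
    (a : Form n X k) (b : Form n X l) : Form n X m :=
  (fun x => castAt h (wedgeAt (derivForm c a x) (b x))) +
    (-1 : ℂ) ^ k • fun x => castAt h' (wedgeAt (a x) (derivForm c b x))

omit [T2Space X] [CompactSpace X] in
theorem IsSmoothForm.leibnizForm (c : ℂ) (h : k + 1 + l = m) (h' : k + (l + 1) = m)
    {a : Form n X k} {b : Form n X l} (ha : IsSmoothForm a) (hb : IsSmoothForm b) :
    IsSmoothForm (leibnizForm c h h' a b) :=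
  ((ha.derivForm c).wedge h hb).add ((ha.wedge h' (hb.derivForm c)).const_smul _)

omit [IsManifold 𝓘(ℂ, Cn n) ω X] [T2Space X] [CompactSpace X] in
theorem leibnizForm_sum (c : ℂ) (h : k + 1 + l = m) (h' : k + (l + 1) = m) {ι : Type*}
    (s : Finset ι) {a : ι → Form n X k} (ha : ∀ i ∈ s, IsSmoothForm (a i)) (b : Form n X l) :
    leibnizForm c h h' (∑ i ∈ s, a i) b = ∑ i ∈ s, leibnizForm c h h' (a i) b := by
  funext x
  simp only [leibnizForm, derivForm_sum c s ha, Pi.add_apply, Pi.smul_apply, Finset.sum_apply,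
    ← wedgeHom_apply, map_sum, LinearMap.sum_apply, Finset.smul_sum, Finset.sum_add_distrib]

omit [T2Space X] in
-- Stokes in one chart. It suffices that `a` has support in the chart, since every function
-- differentiated below has a coefficient of `a` as a factor.
theorem chartIntegral_leibnizForm (c : ℂ) (h : k + 1 + l = 2 * n) (h' : k + (l + 1) = 2 * n)
    {e : OpenPartialHomeomorph X (Cn n)} (he : e ∈ atlas (Cn n) X) {K : Set X} (hK : IsClosed K)
    (hKe : K ⊆ e.source) {a : Form n X k} {b : Form n X l} (ha : IsSmoothForm a)
    (hb : IsSmoothForm b) (haK : ∀ x ∉ K, a x = 0) :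
    chartIntegral e (leibnizForm c h h' a b) = 0 := by
  set A := inChart e a with hA
  set B := inChart e b with hB
  set F : Equiv.Perm (Fin (2 * n)) → Cn n → ℂ := fun σ y =>
    A y (fun i => frame n (σ (sumIdx h (Sum.inl i.succ)))) *
      B y (fun j => frame n (σ (sumIdx h (Sum.inr j)))) with hF
  have hFs : ∀ σ, ContDiffOn ℝ ∞ (F σ) e.target := fun σ =>
    (contDiffOn_alt_iff.1 (ha e he) _).mul (contDiffOn_alt_iff.1 (hb e he) _)
  have hF0 : ∀ σ, ∀ y ∈ e.target, e.symm y ∉ K → F σ y = 0 := by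
    intro σ y _ hy
    simp [hF, hA, inChart_eq_zero (haK _ hy)]
  set u : Equiv.Perm (Fin (2 * n)) → Cn n := fun σ => frame n (σ (sumIdx h (Sum.inl 0))) with hu
  -- On the frame, the directions `u σ` and `i u σ` do not depend on `y`, so by the product rule
  -- every summand is a constant combination of directional derivatives of `F σ`.
  have hpt : ∀ y ∈ e.target, inChart e (leibnizForm c h h' a b) y (frame n) =
      (k.factorial * l.factorial : ℂ)⁻¹ * ∑ σ : Equiv.Perm (Fin (2 * n)),
        (((Equiv.Perm.sign σ : ℤ) : ℂ) * (1 / 2)) *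
          (fderiv ℝ (F σ) y (u σ) + c * fderiv ℝ (F σ) y (Complex.I • u σ)) := by
    intro y hy
    have h1 : inChart e (leibnizForm c h h' a b) y =
        castAt h (wedgeAt (derivWith c A y) (B y)) +
          (-1 : ℂ) ^ k • castAt h' (wedgeAt (A y) (derivWith c B y)) := by
      rw [leibnizForm, inChart_add, inChart_wedge, inChart_derivForm c ha he hy]
      refine congrArg₂ (· + ·) rfl ?_
      refine (inChart_smul e (fun _ => (-1 : ℂ) ^ k) _ y).trans ?_
      rw [inChart_wedge, inChart_derivForm c hb he hy]
    have h2 := leibniz_antisymmetrized h h' (partWith c (fderiv ℝ A y))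
      (partWith c (fderiv ℝ B y)) (A y) (B y) (frame n)
    rw [h1, eq_inv_mul_iff_mul_eq₀ (factorial_mul_ne_zero k l)]
    refine h2.trans (Finset.sum_congr rfl fun σ _ => ?_)
    have h3 : ∀ v, fderiv ℝ (F σ) y v =
        A y (fun i => frame n (σ (sumIdx h (Sum.inl i.succ)))) *
          fderiv ℝ B y v (fun j => frame n (σ (sumIdx h (Sum.inr j)))) +
        B y (fun j => frame n (σ (sumIdx h (Sum.inr j)))) *
          fderiv ℝ A y v (fun i => frame n (σ (sumIdx h (Sum.inl i.succ)))) := by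
      intro v
      have hdA := ((evalAt fun i => frame n (σ (sumIdx h (Sum.inl i.succ)))).hasFDerivAt).comp y
        (ha.differentiableAt he hy).hasFDerivAt
      have hdB := ((evalAt fun i => frame n (σ (sumIdx h (Sum.inr i)))).hasFDerivAt).comp y
        (hb.differentiableAt he hy).hasFDerivAt
      have := (hdA.mul hdB).fderiv
      exact congrArg (fun L : Cn n →L[ℝ] ℂ => L v) this
    rw [h3, h3]
    simp only [partWith_apply, ContinuousAlternatingMap.smul_apply,
      ContinuousAlternatingMap.add_apply, smul_eq_mul, hu]
    ring
  have hint : ∀ σ v, IntegrableOn (fun y => fderiv ℝ (F σ) y v) e.target := fun σ v =>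
    integrableOn_chart hK hKe
      (((hFs σ).continuousOn_fderiv_of_isOpen e.open_target (by simp)).clm_apply
        continuousOn_const)
      (fderiv_eq_zero_of_notMem hK (hF0 σ) v)
  have hint' : ∀ σ, IntegrableOn (fun y => (((Equiv.Perm.sign σ : ℤ) : ℂ) * (1 / 2)) *
      (fderiv ℝ (F σ) y (u σ) + c * fderiv ℝ (F σ) y (Complex.I • u σ))) e.target := fun σ =>
    ((hint σ _).add ((hint σ _).const_mul c)).const_mul _
  rw [chartIntegral, setIntegral_congr_fun e.open_target.measurableSet hpt, integral_const_mul,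
    integral_finsetSum _ fun σ _ => hint' σ]
  refine mul_eq_zero_of_right _ (Finset.sum_eq_zero fun σ _ => ?_)
  rw [integral_const_mul, integral_add (hint σ _) ((hint σ _).const_mul c), integral_const_mul,
    setIntegral_fderiv_eq_zero hK hKe (hFs σ) (hF0 σ),
    setIntegral_fderiv_eq_zero hK hKe (hFs σ) (hF0 σ)]
  simp

/-- The expression is additive in `a`, and the cut off pieces sum to `a`; cutting before
differentiating means that no derivative of the partition of unity has to be cancelled. -/
theorem integralTop_leibnizForm (c : ℂ) (h : k + 1 + l = 2 * n) (h' : k + (l + 1) = 2 * n)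
    {a : Form n X k} {b : Form n X l} (ha : IsSmoothForm a) (hb : IsSmoothForm b) :
    integralTop (leibnizForm c h h' a b) = 0 := by
  rw [← sum_cutoff a, leibnizForm_sum c h h' _ fun i _ => ha.cutoff i,
    integralTop_sum _ fun i _ => (ha.cutoff i).leibnizForm c h h' hb]
  refine Finset.sum_eq_zero fun i _ => ?_
  have hz : ∀ x ∉ tsupport (chartPartition n X i), cutoff i a x = 0 := fun x hx =>
    cutoff_eq_zero hx a
  rw [integralTop_eq_chartIntegral (chart_mem_atlas _ i) (isClosed_tsupport _)
    (tsupport_chartPartition i) ((ha.cutoff i).leibnizForm c h h' hb)]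
  · exact chartIntegral_leibnizForm c h h' (chart_mem_atlas _ i) (isClosed_tsupport _)
      (tsupport_chartPartition i) (ha.cutoff i) hb hz
  · intro x hx
    have h1 : derivForm c (cutoff i a) x = 0 := by
      refine derivForm_eq_zero c ?_
      filter_upwards [(isClosed_tsupport _).isOpen_compl.eventually_mem hx] with z hz'
      exact hz z hz'
    simp only [leibnizForm, Pi.add_apply, Pi.smul_apply, ← wedgeHom_apply, h1, hz x hx, map_zero,
      LinearMap.zero_apply, smul_zero, add_zero]

/-- Integration by parts for `∂` and `∂̄`. -/
theorem integralTop_derivForm_wedge (c : ℂ) (h : k + 1 + l = 2 * n) (h' : k + (l + 1) = 2 * n)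
    {a : Form n X k} {b : Form n X l} (ha : IsSmoothForm a) (hb : IsSmoothForm b) :
    integralTop (fun x => castAt h (wedgeAt (derivForm c a x) (b x))) =
      (-1) ^ (k + 1) * integralTop (fun x => castAt h' (wedgeAt (a x) (derivForm c b x))) := by
  have h1 := integralTop_leibnizForm c h h' ha hb
  rw [leibnizForm, integralTop_add ((ha.derivForm c).wedge h hb)
    ((ha.wedge h' (hb.derivForm c)).const_smul _), integralTop_smul] at h1
  rw [pow_succ]
  linear_combination h1

end Integral

end KaehlerForms

namespace KaehlerForms

variable {n k l m : ℕ} {X : Type*} [TopologicalSpace X] [ChartedSpace (Cn n) X]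
  [IsManifold 𝓘(ℂ, Cn n) ω X]

/-! ### Smoothness of the Hodge star -/

theorem contMDiff_const_section (u : Cn n) : ContMDiff 𝓘(ℝ, Cn n) 𝓘(ℝ, Cn n).tangent ∞
    (fun y : Cn n => (⟨y, u⟩ : TangentBundle 𝓘(ℝ, Cn n) (Cn n))) := by
  intro y
  rw [Bundle.contMDiffAt_totalSpace]
  refine ⟨contMDiffAt_id, ?_⟩
  refine (contMDiffAt_const (c := u)).congr_of_eventuallyEq (Filter.Eventually.of_forall fun z => ?_)
  simp

/-- The coordinate fields of a chart are smooth sections of `TX`, being images of constant fields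
under the tangent map. Inserting them into the metric, a smooth bundle section, gives smooth
coefficients. -/
theorem contMDiffOn_frameField {e : OpenPartialHomeomorph X (Cn n)} (he : e ∈ atlas (Cn n) X)
    (u : Cn n) : ContMDiffOn 𝓘(ℝ, Cn n) 𝓘(ℝ, Cn n).tangent ∞
      (fun y : Cn n => (⟨e.symm y, mfderiv 𝓘(ℝ, Cn n) 𝓘(ℝ, Cn n) e.symm y u⟩ :
        TangentBundle 𝓘(ℝ, Cn n) X)) e.target := by
  have h1 := (contMDiffOn_symm_of_mem_maximalAtlas (I := 𝓘(ℝ, Cn n)) (n := ∞)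
    (IsManifold.subset_maximalAtlas he)).contMDiffOn_tangentMapWithin (m := ∞) (by simp)
      e.open_target.uniqueMDiffOn
  refine (h1.comp (contMDiff_const_section u).contMDiffOn fun y hy => hy).congr fun y hy => ?_
  simp only [Function.comp_apply, tangentMapWithin]
  rw [mfderivWithin_of_isOpen e.open_target hy]

theorem contDiffOn_metric (h : KaehlerMetric n X) {e : OpenPartialHomeomorph X (Cn n)}
    (he : e ∈ atlas (Cn n) X) (u v : Cn n) : ContDiffOn ℝ ∞ (fun y =>
      h.g (e.symm y) (mfderiv 𝓘(ℝ, Cn n) 𝓘(ℝ, Cn n) e.symm y u)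
        (mfderiv 𝓘(ℝ, Cn n) 𝓘(ℝ, Cn n) e.symm y v)) e.target := by
  rw [← contMDiffOn_iff_contDiffOn]
  intro y hy
  have h1 : ContMDiffWithinAt 𝓘(ℝ, Cn n) (𝓘(ℝ, Cn n).prod 𝓘(ℝ)) ∞
      (fun y => Bundle.TotalSpace.mk' ℝ (E := Bundle.Trivial X ℝ) (e.symm y)
        (h.inner (e.symm y) (mfderiv 𝓘(ℝ, Cn n) 𝓘(ℝ, Cn n) e.symm y u)
        (mfderiv 𝓘(ℝ, Cn n) 𝓘(ℝ, Cn n) e.symm y v))) e.target y := by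
    apply ContMDiffWithinAt.clm_bundle_apply₂ (F₁ := Cn n) (F₂ := Cn n)
      (E₁ := fun x : X => TangentSpace 𝓘(ℝ, Cn n) x) (E₂ := fun x : X => TangentSpace 𝓘(ℝ, Cn n) x)
    · exact ContMDiffAt.comp_contMDiffWithinAt y h.contMDiff.contMDiffAt
        (contMDiffOn_symm_of_mem_maximalAtlas (IsManifold.subset_maximalAtlas he) y hy)
    · exact contMDiffOn_frameField he u y hy
    · exact contMDiffOn_frameField he v y hy
  simp only [Bundle.contMDiffWithinAt_totalSpace] at h1
  exact h1.2

theorem contDiffOn_det {E ι : Type*} [NormedAddCommGroup E] [NormedSpace ℝ E] [Fintype ι]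
    [DecidableEq ι] {r : ℕ∞ω} {s : Set E} {M : E → Matrix ι ι ℝ}
    (hM : ∀ i j, ContDiffOn ℝ r (fun y => M y i j) s) :
    ContDiffOn ℝ r (fun y => (M y).det) s := by
  simp only [Matrix.det_apply']
  exact ContDiffOn.sum fun σ _ => contDiffOn_const.mul (contDiffOn_prod fun i _ => hM _ _)

/-- By Cramer's rule the entries are determinants divided by a nonvanishing determinant. -/
theorem contDiffOn_matrix_inv {E ι : Type*} [NormedAddCommGroup E] [NormedSpace ℝ E] [Fintype ι]
    [DecidableEq ι] {r : ℕ∞ω} {s : Set E} {M : E → Matrix ι ι ℝ}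
    (hM : ∀ i j, ContDiffOn ℝ r (fun y => M y i j) s) (h0 : ∀ y ∈ s, (M y).det ≠ 0) (i j : ι) :
    ContDiffOn ℝ r (fun y => (M y)⁻¹ i j) s := by
  simp only [Matrix.inv_def, Ring.inverse_eq_inv, Matrix.smul_apply, smul_eq_mul,
    Matrix.adjugate_apply]
  refine ((contDiffOn_det hM).inv h0).mul (contDiffOn_det fun i' j' => ?_)
  by_cases h : i' = j
  · subst h
    simpa using contDiffOn_const
  · simpa [Matrix.updateRow_ne h] using hM i' j'

theorem contDiffOn_starAt {E : Type*} [NormedAddCommGroup E] [NormedSpace ℝ E] {r : ℕ∞ω}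
    {s : Set E} (h : k + l = 2 * n) {G : E → Cn n →L[ℝ] Cn n →L[ℝ] ℝ}
    (hG : ∀ u v, ContDiffOn ℝ r (fun y => G y u v) s) (h0 : ∀ y ∈ s, 0 < (gram (G y)).det)
    {β : E → Alt n k} (hβ : ContDiffOn ℝ r β s) :
    ContDiffOn ℝ r (fun y => starAt h (G y) (β y)) s := by
  have hg : ∀ i j, ContDiffOn ℝ r (fun y => gram (G y) i j) s := fun i j => hG _ _
  rw [contDiffOn_alt_iff] at hβ ⊢
  intro v
  simp only [starAt_apply]
  have hof : ∀ {f : E → ℝ}, ContDiffOn ℝ r f s → ContDiffOn ℝ r (fun y => (f y : ℂ)) s :=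
    fun hf => Complex.ofRealCLM.contDiff.comp_contDiffOn hf
  refine contDiffOn_const.mul (ContDiffOn.sum fun I _ => ContDiffOn.sum fun J _ =>
    (hof (contDiffOn_prod fun t _ => contDiffOn_matrix_inv hg (fun y hy => (h0 y hy).ne') _ _)).mul
      ((Complex.conjCLE.toContinuousLinearMap.contDiff.comp_contDiffOn (hβ _)).mul ?_))
  have hvol : ∀ y, volAlg (G y) (fun j => Sum.elim (fun s => frame n (J s)) v ((sumIdx h).symm j)) =
      ((Matrix.of fun j => realCoords n
        (Sum.elim (fun s => frame n (J s)) v ((sumIdx h).symm j))).det : ℂ) *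
          (Real.sqrt (gram (G y)).det : ℂ) := by
    intro y
    rw [topForm_apply, volAlg_frame]
  simp only [hvol]
  exact contDiffOn_const.mul (hof ((contDiffOn_det hg).sqrt fun y hy => (h0 y hy).ne'))

/-! ### The Hodge star in charts. -/

section Metric

variable (h : KaehlerMetric n X)

theorem KaehlerMetric.exists_frame (x : X) :
    0 < (gram (h.g x)).det ∧ ∃ P, (gram (h.g x))⁻¹ = P * P.transpose :=
  exists_orthonormal_frame (h.symm x) (h.pos x)

/-- The metric in a chart. -/
noncomputable def chartMetric (e : OpenPartialHomeomorph X (Cn n)) (y : Cn n) :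
    Cn n →L[ℝ] Cn n →L[ℝ] ℝ :=
  (h.g (e.symm y)).bilinearComp
    (mfderiv 𝓘(ℝ, Cn n) 𝓘(ℝ, Cn n) e.symm y : Cn n →L[ℝ] Cn n)
    (mfderiv 𝓘(ℝ, Cn n) 𝓘(ℝ, Cn n) e.symm y : Cn n →L[ℝ] Cn n)

variable {e : OpenPartialHomeomorph X (Cn n)}

theorem det_mfderiv_symm_pos (he : e ∈ atlas (Cn n) X) {y : Cn n} (hy : y ∈ e.target) :
    0 < (mfderiv 𝓘(ℝ, Cn n) 𝓘(ℝ, Cn n) e.symm y : Cn n →L[ℝ] Cn n).det := by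
  rw [mfderiv_symm_eq he hy]
  exact det_fderiv_transition_pos he (chart_mem_atlas _ _) hy (mem_chart_source _ _)

theorem det_gram_chartMetric_pos (he : e ∈ atlas (Cn n) X) {y : Cn n} (hy : y ∈ e.target) :
    0 < (gram (chartMetric h e y)).det := by
  have key : ∀ (g : Cn n →L[ℝ] Cn n →L[ℝ] ℝ) (A : Cn n →L[ℝ] Cn n), 0 < (gram g).det →
      0 < A.det → 0 < (gram (g.bilinearComp A A)).det := fun g A hg hA => by
    rw [gram_bilinearComp, Matrix.det_mul, Matrix.det_mul, Matrix.det_transpose, det_frameMatrix]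
    exact mul_pos (mul_pos hA hg) hA
  exact key _ _ (h.exists_frame _).1 (det_mfderiv_symm_pos he hy)

/-- The derivative of the parametrization is an orientation preserving isometry from the chart
metric to `g`, so `starAt_comp` applies. -/
theorem inChart_star (hkl : k + l = 2 * n) (he : e ∈ atlas (Cn n) X) (b : Form n X k) {y : Cn n}
    (hy : y ∈ e.target) :
    inChart e (fun x => starAt hkl (h.g x) (b x)) y =
      starAt hkl (chartMetric h e y) (inChart e b y) := by
  obtain ⟨P, hP⟩ := (h.exists_frame (e.symm y)).2
  exact (starAt_comp hkl hP (det_mfderiv_symm_pos he hy) _).symm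

theorem IsSmoothForm.star (hkl : k + l = 2 * n) {b : Form n X k} (hb : IsSmoothForm b) :
    IsSmoothForm (fun x => starAt hkl (h.g x) (b x)) := fun e he =>
  (contDiffOn_starAt hkl (contDiffOn_metric h he)
    (fun _ hy => det_gram_chartMetric_pos h he hy) (hb e he)).congr
      fun _ hy => inChart_star h hkl he b hy

theorem hodgeStar_apply (hkl : k + l = 2 * n) (b : TotalForm n X) (x : X) :
    hodgeStar h b l x = starAt hkl (h.g x) (b k x) := by
  obtain rfl : k = 2 * n - l := by omega
  rw [hodgeStar, dif_pos (by omega)]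

end Metric

/-! ### Inhomogeneous forms -/

/-- The common form of the operators `∂` and `∂̄` on inhomogeneous forms. -/
noncomputable def derivTotal (c : ℂ) (a : TotalForm n X) : TotalForm n X
  | 0 => 0
  | k + 1 => derivForm c (a k)

omit [IsManifold 𝓘(ℂ, Cn n) ω X] in
theorem del_eq (a : TotalForm n X) : del a = derivTotal (-Complex.I) a := by
  funext k
  cases k with
  | zero => rfl
  | succ k => exact delForm_eq (a k)

omit [IsManifold 𝓘(ℂ, Cn n) ω X] in
theorem delbar_eq (a : TotalForm n X) : delbar a = derivTotal Complex.I a := by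
  funext k
  cases k <;> rfl

theorem IsSmooth.derivTotal (c : ℂ) {a : TotalForm n X} (ha : IsSmooth a) :
    IsSmooth (derivTotal c a) := by
  intro k
  cases k with
  | zero => exact isSmoothForm_zero
  | succ k => exact (ha k).derivForm c

omit [IsManifold 𝓘(ℂ, Cn n) ω X] in
theorem IsSmooth.const_smul (c : ℂ) {a : TotalForm n X} (ha : IsSmooth a) :
    IsSmooth (c • a) := fun k => (ha k).const_smul c

theorem IsSmooth.hodgeStar (h : KaehlerMetric n X) {a : TotalForm n X} (ha : IsSmooth a) :
    IsSmooth (hodgeStar h a) := by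
  intro l
  by_cases hl : l ≤ 2 * n
  · have h1 : KaehlerForms.hodgeStar h a l =
        fun x => starAt (Nat.sub_add_cancel hl) (h.g x) (a (2 * n - l) x) :=
      funext fun x => hodgeStar_apply h (Nat.sub_add_cancel hl) a x
    rw [h1]
    exact (ha _).star h _
  · have h1 : KaehlerForms.hodgeStar h a l = 0 := by
      funext x
      rw [KaehlerForms.hodgeStar, dif_neg hl]
      rfl
    rw [h1]
    exact isSmoothForm_zero

/-- The grading operator, `(-1)^k` on forms of degree `k`. -/
noncomputable def gradeSign (a : TotalForm n X) : TotalForm n X := fun k => (-1 : ℂ) ^ k • a k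

omit [IsManifold 𝓘(ℂ, Cn n) ω X] in
theorem IsSmooth.gradeSign {a : TotalForm n X} (ha : IsSmooth a) : IsSmooth (gradeSign a) :=
  fun k => (ha k).const_smul _

omit [TopologicalSpace X] [ChartedSpace (Cn n) X] [IsManifold 𝓘(ℂ, Cn n) ω X] in
theorem gradeSign_gradeSign (a : TotalForm n X) : gradeSign (gradeSign a) = a := by
  funext k
  simp only [gradeSign, smul_smul, ← mul_pow]
  simp

omit [TopologicalSpace X] [ChartedSpace (Cn n) X] [IsManifold 𝓘(ℂ, Cn n) ω X] in
theorem HasParity.gradeSign_eq {d : ℕ} {a : TotalForm n X} (ha : HasParity d a) :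
    gradeSign a = (-1 : ℂ) ^ d • a := by
  funext k
  by_cases hk : k % 2 = d % 2
  · have : (-1 : ℂ) ^ k = (-1) ^ d := by
      rw [← Nat.div_add_mod k 2, ← Nat.div_add_mod d 2, hk, pow_add, pow_add, pow_mul, pow_mul]
      simp
    simp only [gradeSign, Pi.smul_apply, this]
  · simp only [gradeSign, Pi.smul_apply, ha k hk]
    funext x
    exact (smul_zero (M := ℂ) (A := Alt n k) ((-1) ^ k)).trans
      (smul_zero (M := ℂ) (A := Alt n k) ((-1) ^ d)).symm

/-- The real dimension `2n` is even, so `l` and `2n - l` have the same parity. -/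
theorem HasParity.hodgeStar (h : KaehlerMetric n X) {d : ℕ} {a : TotalForm n X}
    (ha : HasParity d a) : HasParity d (hodgeStar h a) := by
  intro l hl
  funext x
  by_cases hln : l ≤ 2 * n
  · rw [hodgeStar_apply h (Nat.sub_add_cancel hln), ha (2 * n - l) (by omega)]
    ext v
    simp [starAt_apply]
  · rw [KaehlerForms.hodgeStar, dif_neg hln]
    rfl

omit [IsManifold 𝓘(ℂ, Cn n) ω X] in
theorem HasParity.derivTotal (c : ℂ) {d : ℕ} {a : TotalForm n X} (ha : HasParity d a) :
    HasParity (d + 1) (derivTotal c a) := by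
  intro k hk
  cases k with
  | zero => rfl
  | succ k =>
    rw [KaehlerForms.derivTotal, ha k (by omega)]
    exact derivForm_zero c

theorem HasParity.delStar (h : KaehlerMetric n X) {d : ℕ} {a : TotalForm n X}
    (ha : HasParity d a) : HasParity (d + 1) (delStar h a) := by
  intro k hk
  rw [KaehlerForms.delStar, Pi.neg_apply, del_eq,
    ((ha.hodgeStar h).derivTotal _).hodgeStar h k hk, neg_zero]

/-! ### The integral and the inner product -/

section Integral

variable [T2Space X] [CompactSpace X]

/-- The integral of the wedge product of two homogeneous components. -/
noncomputable def pairing (h : k + l = 2 * n) (a b : TotalForm n X) : ℂ :=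
  integralTop fun x => castAt h (wedgeAt (a k x) (b l x))

theorem pairing_congr {l' : ℕ} (h : k + l = 2 * n) (h' : k + l' = 2 * n) (a b : TotalForm n X) :
    pairing h a b = pairing h' a b := by
  obtain rfl : l = l' := by omega
  rfl

theorem intX_wedge {a b : TotalForm n X} (ha : IsSmooth a) (hb : IsSmooth b) :
    intX (wedge a b) = ∑ k : Fin (2 * n + 1),
      pairing (Nat.add_sub_of_le (Nat.lt_succ_iff.1 k.2)) a b := by
  have h1 := integralTop_sum Finset.univ (a := fun (k : Fin (2 * n + 1)) x =>
    castAt (Nat.add_sub_of_le (Nat.lt_succ_iff.1 k.2)) (wedgeAt (a k x) (b (2 * n - k) x)))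
    fun k _ => (ha _).wedge _ (hb _)
  refine Eq.trans ?_ h1
  rw [intX]
  congr 1
  funext x
  rw [Finset.sum_apply]
  rfl

theorem pairing_zero_left (h : k + l = 2 * n) {a : TotalForm n X} (ha : a k = 0)
    (b : TotalForm n X) : pairing h a b = 0 := by
  rw [pairing, ha, ← integralTop_zero (n := n) (X := X)]
  congr 1
  funext x
  change wedgeHom h 0 (b l x) = 0
  rw [map_zero, LinearMap.zero_apply]

theorem pairing_zero_right (h : k + l = 2 * n) (a : TotalForm n X) {b : TotalForm n X}
    (hb : b l = 0) : pairing h a b = 0 := by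
  rw [pairing, hb, ← integralTop_zero (n := n) (X := X)]
  congr 1
  funext x
  change wedgeHom h (a k x) 0 = 0
  rw [map_zero]

theorem pairing_gradeSign (h : k + l = 2 * n) (a b : TotalForm n X) :
    pairing h (gradeSign a) b = (-1) ^ k * pairing h a b := by
  rw [pairing, pairing, ← integralTop_smul]
  congr 1
  funext x
  change wedgeHom h ((-1 : ℂ) ^ k • a k x) (b l x) = (-1 : ℂ) ^ k • wedgeHom h (a k x) (b l x)
  rw [map_smul, LinearMap.smul_apply]

/-- Integration by parts for `∂` and `∂̄` on inhomogeneous forms. -/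
theorem intX_derivTotal_wedge (c : ℂ) {a b : TotalForm n X} (ha : IsSmooth a) (hb : IsSmooth b) :
    intX (wedge (derivTotal c a) b) = -intX (wedge (gradeSign a) (derivTotal c b)) := by
  rw [intX_wedge (ha.derivTotal c) hb, intX_wedge ha.gradeSign (hb.derivTotal c),
    Fin.sum_univ_succ, Fin.sum_univ_castSucc, pairing_zero_left _ rfl, zero_add, neg_add,
    ← Finset.sum_neg_distrib]
  -- The boundary terms vanish on both sides because a derivative has no component of degree `0`.
  -- The term `j + 1` on the left is then matched with the term `j` on the right.
  have h0 : pairing (Nat.add_sub_of_le (Nat.lt_succ_iff.1 (Fin.last (2 * n)).2)) (gradeSign a)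
      (derivTotal c b) = 0 := by
    have h1 : (Fin.last (2 * n) : ℕ) + 0 = 2 * n := by simp
    rw [pairing_congr _ h1]
    exact pairing_zero_right _ _ rfl
  rw [h0, neg_zero, add_zero]
  refine Finset.sum_congr rfl fun j _ => ?_
  have h2 : (j : ℕ) + ((2 * n - (j + 1)) + 1) = 2 * n := by omega
  have h3 : (j : ℕ) + 1 + (2 * n - (j + 1)) = 2 * n := by omega
  have h4 := integralTop_derivForm_wedge c h3 h2 (ha j) (hb (2 * n - (j + 1)))
  rw [pairing_congr (k := (j.castSucc : ℕ)) _ h2, pairing_gradeSign]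
  refine h4.trans ?_
  rw [pow_succ, mul_neg_one, neg_mul]
  rfl

variable (h : KaehlerMetric n X)

theorem innerL2_eq (a b : TotalForm n X) : innerL2 h a b = intX (wedge a (hodgeStar h b)) := by
  rw [innerL2, intX]
  congr 1
  funext x
  obtain ⟨hd, P, hP⟩ := h.exists_frame x
  rw [wedge, Finset.sum_range]
  refine (Finset.sum_smul (R := ℂ) (M := Alt n (2 * n))).trans ?_
  refine Finset.sum_congr rfl fun k _ => ?_
  rw [hodgeStar_apply h (Nat.add_sub_of_le (Nat.lt_succ_iff.1 k.2)), wedge_starAt _ hd hP]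

/-- The integrands agree pointwise by `wedge_eq_inner_starAt`, so no regularity is needed;
`gradeSign` carries the sign `(-1)^k`. -/
theorem intX_wedge_eq_inner (a b : TotalForm n X) :
    intX (wedge a b) = innerL2 h (gradeSign a) (hodgeStar h b) := by
  rw [innerL2, intX]
  congr 1
  funext x
  obtain ⟨hd, P, hP⟩ := h.exists_frame x
  rw [wedge, Finset.sum_range]
  refine Eq.trans ?_ (Finset.sum_smul (R := ℂ) (M := Alt n (2 * n))).symm
  refine Finset.sum_congr rfl fun k _ => ?_
  have hk : (k : ℕ) ≤ 2 * n := Nat.lt_succ_iff.1 k.2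
  rw [hodgeStar_apply h (Nat.sub_add_cancel hk),
    wedge_eq_inner_starAt _ (Nat.sub_add_cancel hk) hd hP]
  congr 1
  simp only [gradeSign, innerAt_eq_sum hP, Pi.smul_apply, ContinuousAlternatingMap.smul_apply,
    smul_eq_mul, Finset.mul_sum]
  refine Finset.sum_congr rfl fun M _ => ?_
  ring

theorem intX_neg (a : TotalForm n X) : intX (-a) = -intX a := by
  have h1 := integralTop_smul (-1) (a (2 * n))
  rw [neg_one_mul] at h1
  rw [intX, intX, ← h1]
  congr 1
  funext x
  exact (neg_one_smul ℂ (a (2 * n) x)).symm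

theorem innerAt_neg_right (g : Cn n →L[ℝ] Cn n →L[ℝ] ℝ) (α β : Alt n k) :
    innerAt g α (-β) = -innerAt g α β := by
  simp [innerAt, Finset.sum_neg_distrib]

theorem innerAt_smul_left (g : Cn n →L[ℝ] Cn n →L[ℝ] ℝ) (c : ℂ) (α β : Alt n k) :
    innerAt g (c • α) β = c * innerAt g α β := by
  simp only [innerAt, ContinuousAlternatingMap.smul_apply, smul_eq_mul, Finset.mul_sum]
  refine Finset.sum_congr rfl fun I _ => Finset.sum_congr rfl fun J _ => ?_
  ring

theorem innerL2_neg_right (a b : TotalForm n X) : innerL2 h a (-b) = -innerL2 h a b := by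
  have h1 := integralTop_smul (-1) (fun x =>
    (∑ k ∈ Finset.range (2 * n + 1), innerAt (h.g x) (a k x) (b k x)) • volAt (h.g x))
  rw [neg_one_mul] at h1
  rw [innerL2, innerL2, ← h1]
  congr 1
  funext x
  simp only [Pi.neg_apply, innerAt_neg_right, Finset.sum_neg_distrib, Pi.smul_apply]
  exact (neg_smul (R := ℂ) (M := Alt n (2 * n)) _ _).trans
    (neg_one_smul ℂ (_ : Alt n (2 * n))).symm

theorem innerL2_smul_left (c : ℂ) (a b : TotalForm n X) :
    innerL2 h (c • a) b = c * innerL2 h a b := by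
  rw [innerL2, innerL2, ← integralTop_smul]
  congr 1
  funext x
  simp only [Pi.smul_apply, innerAt_smul_left, ← Finset.mul_sum]
  rw [mul_smul]

/-- The partition functions and `vol` are real, so the pointwise Hermitian symmetry passes through
each chart integral. -/
theorem innerL2_conj_symm (a b : TotalForm n X) :
    innerL2 h b a = (starRingEnd ℂ) (innerL2 h a b) := by
  rw [innerL2, innerL2, integralTop_eq_sum, integralTop_eq_sum, map_sum]
  refine Finset.sum_congr rfl fun i _ => ?_
  rw [chartIntegral, chartIntegral, ← integral_conj]
  congr 1
  funext y
  set e := chartAt (Cn n) i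
  have hv : (starRingEnd ℂ) (inChart e (fun x => volAt (h.g x)) y (frame n)) =
      inChart e (fun x => volAt (h.g x)) y (frame n) := volAlg_conj _ _
  have hf : ∀ a b : TotalForm n X, inChart e (cutoff i fun x =>
      (∑ k ∈ Finset.range (2 * n + 1), innerAt (h.g x) (a k x) (b k x)) • volAt (h.g x)) y
        (frame n) = ((chartPartition n X i (e.symm y) : ℝ) : ℂ) *
          ((∑ k ∈ Finset.range (2 * n + 1), innerAt (h.g (e.symm y)) (a k (e.symm y))
            (b k (e.symm y))) * inChart e (fun x => volAt (h.g x)) y (frame n)) := fun _ _ => rfl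
  obtain ⟨P, hP⟩ := (h.exists_frame (e.symm y)).2
  rw [hf, hf, map_mul, map_mul, hv, Complex.conj_ofReal, map_sum]
  congr 2
  exact Finset.sum_congr rfl fun k _ => innerAt_conj_symm hP _ _

/-- `∂*` is the formal adjoint of `∂`. -/
theorem innerL2_del {a b : TotalForm n X} (ha : IsSmooth a) (hb : IsSmooth b) :
    innerL2 h (del a) b = innerL2 h a (delStar h b) := by
  -- The grading signs from Stokes and from `intX_wedge_eq_inner` cancel, and the remaining minus
  -- sign is the one in `∂* = -⋆∂⋆`.
  rw [innerL2_eq, del_eq, intX_derivTotal_wedge _ ha (hb.hodgeStar h), ← del_eq,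
    intX_wedge_eq_inner h, gradeSign_gradeSign, delStar, innerL2_neg_right]

theorem intX_delbar_wedge {d : ℕ} {a b : TotalForm n X} (ha : IsSmooth a) (hb : IsSmooth b)
    (hd : HasParity d a) :
    intX (wedge (delbar a) b) = (-1) ^ (d + 1) * intX (wedge a (delbar b)) := by
  rw [delbar_eq, delbar_eq, intX_derivTotal_wedge _ ha hb, hd.gradeSign_eq,
    intX_wedge (ha.const_smul _) (hb.derivTotal _), intX_wedge ha (hb.derivTotal _),
    ← Finset.sum_neg_distrib, Finset.mul_sum]
  refine Finset.sum_congr rfl fun k _ => ?_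
  rw [pow_succ, mul_neg_one, neg_mul, pairing, pairing, ← integralTop_smul]
  congr 2
  funext x
  change wedgeHom _ ((-1 : ℂ) ^ d • a k x) _ = (-1 : ℂ) ^ d • wedgeHom _ (a k x) _
  rw [map_smul, LinearMap.smul_apply]

theorem intX_delStar_wedge {d : ℕ} {a b : TotalForm n X} (ha : IsSmooth a) (hb : IsSmooth b)
    (hd : HasParity d a) :
    intX (wedge (delStar h a) b) = (-1) ^ d * intX (wedge a (delStar h b)) := by
  have h1 : wedge a (delStar h b) = -wedge a (hodgeStar h (del (hodgeStar h b))) := by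
    funext m x
    simp only [wedge, delStar, Pi.neg_apply, ← Finset.sum_neg_distrib, ← wedgeHom_apply, map_neg]
  -- Since `∂*a` has parity `d + 1`, the left side is `(-1)^(d+1) (∂*a, ⋆b)`. Conjugate symmetry,
  -- used before and after the adjunction `(∂⋆b, a) = (⋆b, ∂*a)`, makes it `(-1)^(d+1) (a, ∂⋆b)`.
  rw [intX_wedge_eq_inner h, (hd.delStar h).gradeSign_eq, innerL2_smul_left, h1, intX_neg,
    ← innerL2_eq, innerL2_conj_symm h (hodgeStar h b), ← innerL2_del h (hb.hodgeStar h) ha,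
    ← innerL2_conj_symm, pow_succ]
  ring

end Integral

end KaehlerForms

/-- On a closed Kähler manifold `∫_X` is an integral for `(Ω^{*,*}(X), ∧, ∂̄, ∂*)`: an even linear
functional that satisfies the two identities of integration by parts. The operator `∂* = - ⋆ ∂ ⋆` is
the formal adjoint of `∂`. -/
theorem lemma2p2 (n : ℕ) (X : Type*) [TopologicalSpace X] [T2Space X] [CompactSpace X]
    [ChartedSpace (Cn n) X] [IsManifold 𝓘(ℂ, Cn n) ω X] (h : KaehlerMetric n X) :
    (∀ a b : TotalForm n X, IsSmooth a → IsSmooth b →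
      innerL2 h (del a) b = innerL2 h a (delStar h b)) ∧
    (∀ a b : TotalForm n X, IsSmooth a → IsSmooth b →
      intX (a + b) = intX a + intX b) ∧
    (∀ (c : ℂ) (a : TotalForm n X), IsSmooth a → intX (c • a) = c * intX a) ∧
    (∀ a : TotalForm n X, IsSmooth a → HasParity 1 a → intX a = 0) ∧
    (∀ (d : ℕ) (a b : TotalForm n X), IsSmooth a → IsSmooth b → HasParity d a →
      intX (wedge (delbar a) b) = (-1) ^ (d + 1) * intX (wedge a (delbar b))) ∧
    (∀ (d : ℕ) (a b : TotalForm n X), IsSmooth a → IsSmooth b → HasParity d a →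
      intX (wedge (delStar h a) b) = (-1) ^ d * intX (wedge a (delStar h b))) := by
  refine ⟨fun a b ha hb => innerL2_del h ha hb, fun a b ha hb => integralTop_add (ha _) (hb _),
    fun c a _ => integralTop_smul c _, fun a _ hp => ?_,
    fun d a b ha hb hd => intX_delbar_wedge ha hb hd,
    fun d a b ha hb hd => intX_delStar_wedge h ha hb hd⟩
  -- The top degree `2n` is even, so an odd form has no component there.
  rw [intX, hp (2 * n) (by omega)]
  exact integralTop_zero
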